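/- Let $D$ be a finite set with at least two elements. For $i\ne j$ in $D$ let $\gamma_{ij}:[0,\infty)\to[0,\infty)$ be measurable, locally integrable functions with $\int_0^\infty\gamma_{ij}(u)\,du=\infty$, and put $\gamma_i=\sum_{j\ne i}\gamma_{ij}$. On a probability space with a filtration $(\mathcal F_t)_{t\ge0}$ let $\varepsilon=(\varepsilon(t))_{t\ge 0}$ be an adapted $D$-valued piecewise constant right-continuous process whose successive switching times satisfy $0=\tau_0<\tau_1<\tau_2<\cdots\to\infty$. Assume that $\varepsilon$ is semi-Markov with hazard rates $\gamma_{ij}$ relative to $(\mathcal F_t)$, that is: (i) for all $n\ge1$, $t\ge0$ and $j\in D$, almost surely on $\{\varepsilon(\tau_{n-1})=i\}$, $$\mathbb P\{\tau_n-\tau_{n-1}>t,\ \varepsilon(\tau_n)=j \mid \tau_0,\varepsilon(\tau_0),\dots,\tau_{n-1},\varepsilon(\tau_{n-1})\}=\mathbf 1_{\{j\ne i\}}\int_t^\infty\gamma_{ij}(u)\exp\Big(-\int_0^u\gamma_i(s)\,ds\Big)du,$$ so that $\gamma_i$ is the hazard rate function of the inter-switching times spent in the state $i$; the law of $\varepsilon(0)$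 is arbitrary; (ii) $\mathbb P(A\mid\mathcal F_t)=\mathbb P(A\mid\sigma(\varepsilon(s),s\le t))$ almost surely, for all $t\ge0$ and all $A\in\sigma(\varepsilon(s),s\ge0)$ (this is automatic if $(\mathcal F_t)$ is the filtration generated by $\varepsilon$). For $i\in D$ let $c_i,h_i:[0,\infty)\to\mathbb R$ be measurable functions, with $c_i$ locally integrable. Let $N(t)=\max\{n:\tau_n\le t\}$ and let $X=T^c+N^h$, where $$T^c(t)=\int_0^t c_{\varepsilon(\tau_{N(u)})}(u-\tau_{N(u)})\,du,\qquad N^h(t)=\sum_{n=1}^{N(t)}h_{\varepsilon(\tau_{n-1})}(\tau_n-\tau_{n-1}),\qquad t\ge0.$$ Then $X$ is an $(\mathcal F_t)$-martingale if and only if, for every $i\in D$, $$\gamma_i(t)h_i(t)+c_i(t)=0\quad\text{for Lebesgue-almost every } t\ge0.$$ -/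

import Mathlib

open MeasureTheory ProbabilityTheory Filter Set
open scoped NNReal

noncomputable section

namespace RegimeSwitching

variable {Ω D : Type*}

/-- The hazard rate `γ_i = ∑_{j ≠ i} γ_ij` of the holding time in the state `i`. -/
def totalHazard [Fintype D] [DecidableEq D] (γ : D → D → ℝ → ℝ) (i : D) (t : ℝ) : ℝ :=
  ∑ j ∈ Finset.univ.erase i, γ i j t

/-- The survival function `exp (-∫₀ᵗ γ_i(u) du)` of the holding time in the state `i`. -/
def survival [Fintype D] [DecidableEq D] (γ : D → D → ℝ → ℝ) (i : D) (t : ℝ) : ℝ :=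
  Real.exp (-∫ u in (0 : ℝ)..t, totalHazard γ i u)

/-- The probability that the holding time in the state `i` exceeds `t` and the next state is `j`:
transitions from `i` to `j ≠ i` occur with instantaneous intensity `γ_ij`, so that the joint law
of (holding time, next state) has density `γ_ij(u) exp (-∫₀ᵘ γ_i)` on `(0, ∞) × {j}`. -/
def transitionTail [Fintype D] [DecidableEq D] (γ : D → D → ℝ → ℝ) (i j : D) (t : ℝ) : ℝ :=
  if i = j then 0 else ∫ u in Ioi t, γ i j u * survival γ i u

/-- Admissible families of hazard rate functions: nonnegative, locally integrable on `[0, ∞)`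
(so that the survival functions `exp (-∫₀ᵗ γ_ij)` are positive) and with infinite total mass.
Only the values for `i ≠ j` and on `[0, ∞)` play a role. -/
structure IsHazardRates (γ : D → D → ℝ → ℝ) : Prop where
  measurable : ∀ i j, i ≠ j → Measurable (γ i j)
  nonneg : ∀ i j, i ≠ j → ∀ u, 0 < u → 0 ≤ γ i j u
  locallyIntegrable : ∀ i j, i ≠ j → LocallyIntegrableOn (γ i j) (Ici 0)
  nonexploding : ∀ i j, i ≠ j → Tendsto (fun t => ∫ u in (0 : ℝ)..t, γ i j u) atTop atTop

/-- `0 = τ₀ < τ₁ < τ₂ < ⋯ → ∞` are the successive switching times of the piecewise constant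
right-continuous process `ε`. -/
structure IsSwitchingTimes (ε : ℝ≥0 → Ω → D) (τ : ℕ → Ω → ℝ≥0) : Prop where
  zero : ∀ ω, τ 0 ω = 0
  strictMono : ∀ ω, StrictMono fun n => τ n ω
  tendsto : ∀ ω, Tendsto (fun n => τ n ω) atTop atTop
  eq_of_mem : ∀ ω n, ∀ t ∈ Ico (τ n ω) (τ (n + 1) ω), ε t ω = ε (τ n ω) ω
  switch : ∀ ω n, ε (τ (n + 1) ω) ω ≠ ε (τ n ω) ω

/-- The `σ`-algebra generated by `τ₀, ε(τ₀), …, τ_n, ε(τ_n)`. -/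
abbrev history [MeasurableSpace D] (ε : ℝ≥0 → Ω → D) (τ : ℕ → Ω → ℝ≥0) (n : ℕ) :
    MeasurableSpace Ω :=
  ⨆ k : ℕ, ⨆ _ : k ≤ n, MeasurableSpace.comap (fun ω => (τ k ω, ε (τ k ω) ω)) inferInstance

/-- The `σ`-algebra generated by `ε(s)`, `s ≤ t`. -/
abbrev past [MeasurableSpace D] (ε : ℝ≥0 → Ω → D) (t : ℝ≥0) : MeasurableSpace Ω :=
  ⨆ s : ℝ≥0, ⨆ _ : s ≤ t, MeasurableSpace.comap (ε s) inferInstance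

/-- The `σ`-algebra generated by the whole path of `ε`. -/
abbrev wholePath [MeasurableSpace D] (ε : ℝ≥0 → Ω → D) : MeasurableSpace Ω :=
  ⨆ s : ℝ≥0, MeasurableSpace.comap (ε s) inferInstance

/-- `ε` is a semi-Markov process with respect to the filtration `ℱ`, with switching times `τ` and
hazard rate functions `γ`. The law of `ε(0)` is arbitrary. -/
structure IsSemiMarkov [Fintype D] [DecidableEq D] [MeasurableSpace D] {mΩ : MeasurableSpace Ω}
    (P : Measure Ω) (ℱ : Filtration ℝ≥0 mΩ) (γ : D → D → ℝ → ℝ)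
    (ε : ℝ≥0 → Ω → D) (τ : ℕ → Ω → ℝ≥0) : Prop where
  adapted : ∀ t, Measurable[ℱ t] (ε t)
  measurable_time : ∀ n, Measurable (τ n)
  switchingTimes : IsSwitchingTimes ε τ
  /-- Markov renewal property: given `τ₀, ε(τ₀), …, τ_n, ε(τ_n)`, the joint law of the next
  inter-switching time and the next state is the one of the state `ε(τ_n)`. -/
  renewal : ∀ (n : ℕ) (j : D) (t : ℝ), 0 ≤ t →
    P⟦{ω | t < (τ (n + 1) ω : ℝ) - τ n ω ∧ ε (τ (n + 1) ω) ω = j} | history ε τ n⟧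
      =ᵐ[P] fun ω => transitionTail γ (ε (τ n ω) ω) j t
  /-- For the prediction of `ε` at time `t`, the information `ℱ t` is worth no more than the past
  of `ε`. This is automatic if `ℱ` is generated by `ε`. -/
  immersed : ∀ (t : ℝ≥0) (A : Set Ω), MeasurableSet[wholePath ε] A →
    P⟦A | ℱ t⟧ =ᵐ[P] P⟦A | past ε t⟧

/-- The counting process `N(t) = max {n | τ_n ≤ t}`. -/
def count (τ : ℕ → Ω → ℝ≥0) (t : ℝ) (ω : Ω) : ℕ := sSup {n | (τ n ω : ℝ) ≤ t}

/-- The renewed process `z†(t) = z_{ε(τ_{n-1})}(t - τ_{n-1})` for `t ∈ [τ_{n-1}, τ_n)`. -/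
def dagger (ε : ℝ≥0 → Ω → D) (τ : ℕ → Ω → ℝ≥0) (z : D → ℝ → ℝ) (t : ℝ) (ω : Ω) : ℝ :=
  z (ε (τ (count τ t ω) ω) ω) (t - τ (count τ t ω) ω)

/-- The generalised telegraph process `T^c(t) = ∫₀ᵗ c†(u) du`. -/
def telegraph (ε : ℝ≥0 → Ω → D) (τ : ℕ → Ω → ℝ≥0) (c : D → ℝ → ℝ) (t : ℝ≥0) (ω : Ω) : ℝ :=
  ∫ u in (0 : ℝ)..t, dagger ε τ c u ω

/-- The pure jump process `N^h(t) = ∑_{n=1}^{N(t)} h_{ε(τ_{n-1})}(τ_n - τ_{n-1})`. -/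
def jump (ε : ℝ≥0 → Ω → D) (τ : ℕ → Ω → ℝ≥0) (h : D → ℝ → ℝ) (t : ℝ≥0) (ω : Ω) : ℝ :=
  ∑ n ∈ Finset.range (count τ t ω), h (ε (τ n ω) ω) ((τ (n + 1) ω : ℝ) - τ n ω)

/-- The switching process `X = T^c + N^h`. -/
def switchingProcess (ε : ℝ≥0 → Ω → D) (τ : ℕ → Ω → ℝ≥0) (c h : D → ℝ → ℝ)
    (t : ℝ≥0) (ω : Ω) : ℝ :=
  telegraph ε τ c t ω + jump ε τ h t ω

end RegimeSwitching

end

noncomputable section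

namespace RegimeSwitching

open scoped ENNReal Topology

variable {Ω D : Type*}

/-! ### Calculus of primitives of integrable functions -/

section Calculus

/-! Sufficiency. Cut `X(t)` into the gains over the single cycles `[τ_n, τ_{n+1})` (`cycleGain`,
`hasSum_cycleGain`). Suppose that a cycle starts at `r ≤ t` in the state `i`, and let `a = t - r`
and let `S_i` be the survival function. The drift of the cycle has mean `∫₀ᵃ c_i S_i` by Fubini, and
its jump has mean `∫₀ᵃ γ_i h_i S_i` because the holding time has density `γ_i S_i`. The balance
equation makes the sum zero (`integral_cycleGain`), so by the renewal property the gain integrates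
to zero over every event of the history up to `τ_n`.

To pass to events `B` known at a deterministic time `s`, immersion reduces to `B` in the past of
`ε`. Before `τ_{n+1}` such a `B` coincides with an event of the history (`exists_history_set`), and
after `τ_{n+1}` the gain no longer changes. Hence each gain is a martingale in `t`
(`setIntegral_cycleGain_eq`). The gains are summed in `L¹` using `P(τ_n ≤ t) ≤ eᵗ ρⁿ` with `ρ < 1`,
a Laplace transform bound.

Necessity. Integrability of `X` first gives local integrability of `γ_i h_i`. Given the history up
to `τ_{n+1}`, the next cycle outlasts `t` with probability bounded below; on that event a jump
completed by `t` is the last one, so it is controlled by `X(t)`, the drift and the earlier jumps,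
and induction applies (`lintegral_jump_ne_top`). Then `N^h` compensated by the drift `-γ_i h_i` is a
martingale by sufficiency, and subtracting it from `X` leaves the telegraph process with drift `z_i
= γ_i h_i + c_i` as a martingale. A continuous martingale of finite variation started at zero
vanishes; here this follows directly from `T(t)² = 2 ∫₀ᵗ z†(u) (T(t) - T(u)) du`, whose expectation
is zero, with Fubini justified by the second moment of `N(t)` (`telegraph_ae_eq_zero`). Since every
state is visited and held for arbitrarily long with positive probability, every primitive of `z_i`
vanishes, and so does `z_i`. -/

/-- Postcomposition with a Lipschitz function preserves absolute continuity. -/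
theorem absolutelyContinuousOnInterval_comp {f φ : ℝ → ℝ} {a b : ℝ} {s : Set ℝ} {K : ℝ≥0}
    (hφ : LipschitzOnWith K φ s) (hf : AbsolutelyContinuousOnInterval f a b)
    (hs : MapsTo f (uIcc a b) s) : AbsolutelyContinuousOnInterval (φ ∘ f) a b := by
  unfold AbsolutelyContinuousOnInterval at hf ⊢
  refine squeeze_zero' (Eventually.of_forall fun E => Finset.sum_nonneg fun i _ => dist_nonneg)
    ?_ (by simpa using hf.const_mul (K : ℝ))
  refine Filter.eventually_inf_principal.2 (Eventually.of_forall fun E hE => ?_)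
  rw [Finset.mul_sum]
  refine Finset.sum_le_sum fun i hi => ?_
  exact hφ.dist_le_mul _ (hs (hE.1 i hi).1) _ (hs (hE.1 i hi).2)

/-- Joint measurability in the endpoint and the parameter comes from moving the endpoint into an
indicator, one for each orientation of the interval. -/
theorem measurable_primitive_prod {α : Type*} [MeasurableSpace α] {f : ℝ × α → ℝ}
    (hf : Measurable f) : Measurable fun p : ℝ × α => ∫ u in (0 : ℝ)..p.1, f (u, p.2) := by
  have h1 : ∀ p : ℝ × α, ∫ u in (0 : ℝ)..p.1, f (u, p.2)
      = (∫ u, ({q : (ℝ × α) × ℝ | 0 < q.2 ∧ q.2 ≤ q.1.1}.indicator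
          fun q => f (q.2, q.1.2)) (p, u))
        - ∫ u, ({q : (ℝ × α) × ℝ | q.1.1 < q.2 ∧ q.2 ≤ 0}.indicator
          fun q => f (q.2, q.1.2)) (p, u) := by
    intro p
    rw [intervalIntegral, ← integral_indicator measurableSet_Ioc,
      ← integral_indicator measurableSet_Ioc]
    rfl
  simp_rw [h1]
  have m1 : MeasurableSet {q : (ℝ × α) × ℝ | 0 < q.2 ∧ q.2 ≤ q.1.1} :=
    (measurableSet_lt measurable_const measurable_snd).inter
      (measurableSet_le measurable_snd measurable_fst.fst)
  have m2 : MeasurableSet {q : (ℝ × α) × ℝ | q.1.1 < q.2 ∧ q.2 ≤ 0} :=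
    (measurableSet_lt measurable_fst.fst measurable_snd).inter
      (measurableSet_le measurable_snd measurable_const)
  have hf2 : Measurable fun q : (ℝ × α) × ℝ => f (q.2, q.1.2) :=
    hf.comp (measurable_snd.prodMk measurable_fst.snd)
  exact ((hf2.indicator m1).stronglyMeasurable.integral_prod_right'.measurable).sub
    ((hf2.indicator m2).stronglyMeasurable.integral_prod_right'.measurable)

theorem measurable_primitive {f : ℝ → ℝ} (hf : Measurable f) :
    Measurable fun t : ℝ => ∫ u in (0 : ℝ)..t, f u :=
  (measurable_primitive_prod (hf.comp (measurable_fst (β := Unit)))).comp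
    (measurable_id.prodMk (measurable_const (a := ())))

theorem intervalIntegrable_of_locallyIntegrableOn_Ici {f : ℝ → ℝ}
    (hf : LocallyIntegrableOn f (Ici 0)) {a b : ℝ} (ha : 0 ≤ a) (hb : 0 ≤ b) :
    IntervalIntegrable f volume a b := by
  rw [intervalIntegrable_iff']
  refine hf.integrableOn_compact_subset (fun x hx => ?_) isCompact_uIcc
  exact (le_min ha hb).trans hx.1

theorem locallyIntegrableOn_Ici_of_intervalIntegrable {f : ℝ → ℝ}
    (hf : ∀ t, 0 ≤ t → IntervalIntegrable f volume 0 t) : LocallyIntegrableOn f (Ici 0) := by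
  rw [locallyIntegrableOn_iff (isClosed_Ici.isLocallyClosed)]
  intro k hk hk'
  obtain ⟨t, ht⟩ := hk'.bddAbove
  have h := hf (max t 0) (le_max_right _ _)
  rw [intervalIntegrable_iff_integrableOn_Icc_of_le (le_max_right _ _)] at h
  exact h.mono_set fun x hx => ⟨hk hx, (ht hx).trans (le_max_left _ _)⟩

/-- A locally integrable function on `[0, ∞)` whose primitive vanishes is zero. -/
theorem ae_eq_zero_of_primitive_eq_zero {f : ℝ → ℝ} (hf : LocallyIntegrableOn f (Ici 0))
    (h0 : ∀ t, 0 ≤ t → ∫ u in (0 : ℝ)..t, f u = 0) :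
    ∀ᵐ t ∂(volume.restrict (Ici (0 : ℝ))), f t = 0 := by
  rw [ae_restrict_iff' measurableSet_Ici]
  have h1 : ∀ n : ℕ, ∀ᵐ x, x ∈ uIcc (0 : ℝ) n → ∀ c ∈ uIcc (0 : ℝ) n,
      HasDerivAt (fun x => ∫ t in c..x, f t) (f x) x := fun n =>
    (intervalIntegrable_of_locallyIntegrableOn_Ici hf le_rfl n.cast_nonneg).ae_hasDerivAt_integral
  filter_upwards [ae_all_iff.2 h1, (by simp [ae_iff, measure_singleton] : ∀ᵐ x : ℝ, x ≠ 0)]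
    with x hx hx0 hxn
  have hpos : 0 < x := lt_of_le_of_ne hxn (Ne.symm hx0)
  obtain ⟨n, hn⟩ := exists_nat_ge x
  have hd := hx n (by rw [uIcc_of_le n.cast_nonneg]; exact ⟨hpos.le, hn⟩) 0 left_mem_uIcc
  refine hd.unique ((hasDerivAt_const x (0 : ℝ)).congr_of_eventuallyEq ?_)
  filter_upwards [lt_mem_nhds hpos] with y hy using h0 y hy.le

/-- Integration by parts for `F · F`, written with the future increment `F t - F u`: for a
martingale this is the factor whose conditional expectation at time `u` vanishes. -/
theorem sq_integral_eq {f : ℝ → ℝ} {t : ℝ} (hf : IntervalIntegrable f volume 0 t) :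
    (∫ u in (0 : ℝ)..t, f u) ^ 2 =
      2 * ∫ u in (0 : ℝ)..t, f u * ((∫ w in (0 : ℝ)..t, f w) - ∫ w in (0 : ℝ)..u, f w) := by
  set F : ℝ → ℝ := fun u => ∫ w in (0 : ℝ)..u, f w with hF
  have hac : AbsolutelyContinuousOnInterval F 0 t :=
    hf.absolutelyContinuousOnInterval_intervalIntegral left_mem_uIcc
  have h1 := hac.integral_deriv_mul_eq_sub hac
  have h2 : ∫ u in (0 : ℝ)..t, deriv F u * F u + F u * deriv F u =
      ∫ u in (0 : ℝ)..t, 2 * (f u * F u) := by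
    refine intervalIntegral.integral_congr_ae ?_
    filter_upwards [hf.ae_hasDerivAt_integral] with u hu hu'
    rw [(hu (uIoc_subset_uIcc hu') 0 left_mem_uIcc).deriv]
    ring
  have h3 : F 0 = 0 := intervalIntegral.integral_same
  rw [h2, intervalIntegral.integral_const_mul, h3] at h1
  change F t ^ 2 = 2 * ∫ u in (0 : ℝ)..t, f u * (F t - F u)
  simp_rw [mul_sub]
  rw [intervalIntegral.integral_sub (hf.mul_const _) (hf.mul_continuousOn hac.continuousOn),
    intervalIntegral.integral_mul_const]
  linear_combination h1

end Calculus

/-! ### Hazard rates, survival functions and the law of the holding time -/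

section Hazard

variable [Fintype D] [DecidableEq D] {γ : D → D → ℝ → ℝ}

theorem IsHazardRates.measurable_totalHazard (hγ : IsHazardRates γ) (i : D) :
    Measurable (totalHazard γ i) := by
  unfold totalHazard
  exact Finset.measurable_fun_sum _ fun j hj => hγ.measurable i j (Finset.ne_of_mem_erase hj).symm

theorem IsHazardRates.totalHazard_nonneg (hγ : IsHazardRates γ) (i : D) {u : ℝ} (hu : 0 < u) :
    0 ≤ totalHazard γ i u :=
  Finset.sum_nonneg fun j hj => hγ.nonneg i j (Finset.ne_of_mem_erase hj).symm u hu

theorem IsHazardRates.le_totalHazard (hγ : IsHazardRates γ) {i j : D} (hij : i ≠ j) {u : ℝ}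
    (hu : 0 < u) : γ i j u ≤ totalHazard γ i u :=
  Finset.single_le_sum (f := fun j => γ i j u)
    (fun k hk => hγ.nonneg i k (Finset.ne_of_mem_erase hk).symm u hu)
    (Finset.mem_erase.2 ⟨hij.symm, Finset.mem_univ j⟩)

theorem IsHazardRates.intervalIntegrable_totalHazard (hγ : IsHazardRates γ) (i : D) {a b : ℝ}
    (ha : 0 ≤ a) (hb : 0 ≤ b) : IntervalIntegrable (totalHazard γ i) volume a b := by
  have : totalHazard γ i = ∑ j ∈ Finset.univ.erase i, γ i j := by
    ext u; simp [totalHazard]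
  rw [this]
  exact IntervalIntegrable.sum _ fun j hj => intervalIntegrable_of_locallyIntegrableOn_Ici
    (hγ.locallyIntegrable i j (Finset.ne_of_mem_erase hj).symm) ha hb

theorem survival_pos (γ : D → D → ℝ → ℝ) (i : D) (t : ℝ) : 0 < survival γ i t := Real.exp_pos _

theorem survival_zero (γ : D → D → ℝ → ℝ) (i : D) : survival γ i 0 = 1 := by simp [survival]

theorem IsHazardRates.measurable_survival (hγ : IsHazardRates γ) (i : D) :
    Measurable (survival γ i) :=
  Real.measurable_exp.comp (measurable_primitive (hγ.measurable_totalHazard i)).neg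

theorem IsHazardRates.integral_totalHazard_mono (hγ : IsHazardRates γ) (i : D) {a b : ℝ}
    (ha : 0 ≤ a) (hab : a ≤ b) :
    ∫ u in (0 : ℝ)..a, totalHazard γ i u ≤ ∫ u in (0 : ℝ)..b, totalHazard γ i u := by
  rw [← intervalIntegral.integral_add_adjacent_intervals
    (hγ.intervalIntegrable_totalHazard i le_rfl ha)
    (hγ.intervalIntegrable_totalHazard i ha (ha.trans hab))]
  refine le_add_of_nonneg_right (intervalIntegral.integral_nonneg_of_ae_restrict hab ?_)
  refine (ae_restrict_iff' measurableSet_Icc).2 ?_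
  filter_upwards [(by simp [ae_iff, measure_singleton] : ∀ᵐ x : ℝ, x ≠ 0)] with x hx hx'
  exact hγ.totalHazard_nonneg i (lt_of_le_of_ne (ha.trans hx'.1) hx.symm)

theorem IsHazardRates.survival_anti (hγ : IsHazardRates γ) (i : D) {a b : ℝ}
    (ha : 0 ≤ a) (hab : a ≤ b) : survival γ i b ≤ survival γ i a :=
  Real.exp_le_exp.2 (neg_le_neg (hγ.integral_totalHazard_mono i ha hab))

theorem IsHazardRates.survival_le_one (hγ : IsHazardRates γ) (i : D) {t : ℝ} (ht : 0 ≤ t) :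
    survival γ i t ≤ 1 := survival_zero γ i ▸ hγ.survival_anti i le_rfl ht

theorem IsHazardRates.tendsto_survival [Nontrivial D] (hγ : IsHazardRates γ) (i : D) :
    Tendsto (survival γ i) atTop (𝓝 0) := by
  obtain ⟨j, hj⟩ := exists_ne i
  refine Real.tendsto_exp_neg_atTop_nhds_zero.comp
    (tendsto_atTop_mono' _ ?_ (hγ.nonexploding i j hj.symm))
  filter_upwards [eventually_ge_atTop 0] with t ht
  refine intervalIntegral.integral_mono_on_of_le_Ioo ht
    (intervalIntegrable_of_locallyIntegrableOn_Ici (hγ.locallyIntegrable i j hj.symm) le_rfl ht)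
    (hγ.intervalIntegrable_totalHazard i le_rfl ht) fun x hx => hγ.le_totalHazard hj.symm hx.1

/-- The hazard is merely integrable, so the survival function need not be differentiable everywhere.
It is absolutely continuous because `exp (-x)` is 1-Lipschitz on `[0, ∞)`, where the cumulative
hazard takes its values. -/
theorem IsHazardRates.absolutelyContinuous_survival (hγ : IsHazardRates γ) (i : D) {a b : ℝ}
    (ha : 0 ≤ a) (hb : 0 ≤ b) : AbsolutelyContinuousOnInterval (survival γ i) a b := by
  have hlip : LipschitzOnWith 1 (fun x : ℝ => Real.exp (-x)) (Ici 0) := by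
    refine (convex_Ici (0 : ℝ)).lipschitzOnWith_of_nnnorm_hasDerivWithin_le
      (f' := fun x => Real.exp (-x) * (-1)) (fun x _ => ?_) fun x hx => ?_
    · exact ((hasDerivAt_neg x).exp).hasDerivWithinAt
    · rw [← NNReal.coe_le_coe, coe_nnnorm]
      simpa [abs_of_pos (Real.exp_pos _)] using hx
  have hac : AbsolutelyContinuousOnInterval
      (fun t => ∫ u in (0 : ℝ)..t, totalHazard γ i u) a b := by
    refine ((hγ.intervalIntegrable_totalHazard i le_rfl
      (ha.trans (le_max_left a b))).absolutelyContinuousOnInterval_intervalIntegral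
        (c := 0) left_mem_uIcc).mono (uIcc_subset_uIcc ?_ ?_) <;>
      rw [uIcc_of_le (ha.trans (le_max_left a b))] <;> constructor <;> simp [ha, hb]
  refine absolutelyContinuousOnInterval_comp (φ := fun x => Real.exp (-x)) (s := Ici 0)
    (f := fun t => ∫ u in (0 : ℝ)..t, totalHazard γ i u) hlip hac fun t ht => ?_
  have := hγ.integral_totalHazard_mono i le_rfl ((le_min ha hb).trans ht.1)
  simpa using this

theorem IsHazardRates.integral_density (hγ : IsHazardRates γ) (i : D) {a b : ℝ}
    (ha : 0 ≤ a) (hb : 0 ≤ b) :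
    ∫ u in a..b, totalHazard γ i u * survival γ i u = survival γ i a - survival γ i b := by
  have h := (hγ.absolutelyContinuous_survival i ha hb).integral_deriv_eq_sub
  rw [← neg_sub, ← h, ← intervalIntegral.integral_neg]
  refine intervalIntegral.integral_congr_ae ?_
  have hm : (0 : ℝ) ≤ max a b := ha.trans (le_max_left a b)
  filter_upwards [(hγ.intervalIntegrable_totalHazard i le_rfl hm).ae_hasDerivAt_integral]
    with x hx hx'
  have hx0 : min a b < x := hx'.1
  have hd := hx (by rw [uIcc_of_le hm]; exact ⟨((le_min ha hb).trans_lt hx0).le, hx'.2⟩) 0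
    left_mem_uIcc
  have := hd.neg.exp.deriv
  simp only [Pi.neg_apply] at this
  change _ = -deriv (fun x => Real.exp (-∫ u in (0 : ℝ)..x, totalHazard γ i u)) x
  rw [this, survival]
  ring

theorem IsHazardRates.density_nonneg (hγ : IsHazardRates γ) (i : D) {u : ℝ} (hu : 0 < u) :
    0 ≤ totalHazard γ i u * survival γ i u :=
  mul_nonneg (hγ.totalHazard_nonneg i hu) (survival_pos γ i u).le

theorem IsHazardRates.measurable_density (hγ : IsHazardRates γ) (i : D) :
    Measurable fun u => totalHazard γ i u * survival γ i u :=
  (hγ.measurable_totalHazard i).mul (hγ.measurable_survival i)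

theorem IsHazardRates.intervalIntegrable_density (hγ : IsHazardRates γ) (i : D) {a b : ℝ}
    (ha : 0 ≤ a) (hb : 0 ≤ b) :
    IntervalIntegrable (fun u => totalHazard γ i u * survival γ i u) volume a b :=
  (hγ.intervalIntegrable_totalHazard i ha hb).mul_continuousOn
    (hγ.absolutelyContinuous_survival i ha hb).continuousOn

theorem IsHazardRates.tendsto_integral_density [Nontrivial D] (hγ : IsHazardRates γ) (i : D)
    {t : ℝ} (ht : 0 ≤ t) :
    Tendsto (fun b => ∫ u in t..b, totalHazard γ i u * survival γ i u) atTop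
      (𝓝 (survival γ i t)) := by
  have h : Tendsto (fun b => survival γ i t - survival γ i b) atTop (𝓝 (survival γ i t - 0)) :=
    tendsto_const_nhds.sub (hγ.tendsto_survival i)
  rw [sub_zero] at h
  refine h.congr' ?_
  filter_upwards [eventually_ge_atTop 0] with b hb using (hγ.integral_density i ht hb).symm

theorem IsHazardRates.integrableOn_density [Nontrivial D] (hγ : IsHazardRates γ) (i : D)
    {t : ℝ} (ht : 0 ≤ t) :
    IntegrableOn (fun u => totalHazard γ i u * survival γ i u) (Ioi t) := by
  refine integrableOn_Ioi_of_intervalIntegral_norm_tendsto (survival γ i t) t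
    (b := fun b : ℝ => b) (l := atTop) (fun b => ?_) tendsto_id ?_
  · rcases le_or_gt t b with h | h
    · exact (hγ.intervalIntegrable_density i ht (ht.trans h)).1
    · rw [Ioc_eq_empty_of_le h.le]; exact integrableOn_empty
  · refine (hγ.tendsto_integral_density i ht).congr' ?_
    filter_upwards [eventually_ge_atTop t] with b hb
    refine intervalIntegral.integral_congr_ae (ae_of_all _ fun u hu => ?_)
    rw [uIoc_of_le hb] at hu
    exact (Real.norm_of_nonneg (hγ.density_nonneg i (ht.trans_lt hu.1))).symm

theorem IsHazardRates.integral_Ioi_density [Nontrivial D] (hγ : IsHazardRates γ) (i : D)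
    {t : ℝ} (ht : 0 ≤ t) :
    ∫ u in Ioi t, totalHazard γ i u * survival γ i u = survival γ i t :=
  tendsto_nhds_unique
    (intervalIntegral_tendsto_integral_Ioi t (hγ.integrableOn_density i ht) tendsto_id)
    (hγ.tendsto_integral_density i ht)

theorem IsHazardRates.integrableOn_transition [Nontrivial D] (hγ : IsHazardRates γ) {i j : D}
    (hij : i ≠ j) {t : ℝ} (ht : 0 ≤ t) :
    IntegrableOn (fun u => γ i j u * survival γ i u) (Ioi t) := by
  refine (hγ.integrableOn_density i ht).mono'
    ((hγ.measurable i j hij).mul (hγ.measurable_survival i)).aestronglyMeasurable ?_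
  refine (ae_restrict_iff' measurableSet_Ioi).2 (ae_of_all _ fun u hu => ?_)
  have hu0 : 0 < u := ht.trans_lt hu
  rw [Real.norm_of_nonneg (mul_nonneg (hγ.nonneg i j hij u hu0) (survival_pos γ i u).le)]
  exact mul_le_mul_of_nonneg_right (hγ.le_totalHazard hij hu0) (survival_pos γ i u).le

theorem IsHazardRates.sum_transitionTail [Nontrivial D] (hγ : IsHazardRates γ) (i : D)
    {t : ℝ} (ht : 0 ≤ t) : ∑ j, transitionTail γ i j t = survival γ i t := by
  rw [← hγ.integral_Ioi_density i ht, ← Finset.add_sum_erase _ _ (Finset.mem_univ i)]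
  simp_rw [totalHazard, Finset.sum_mul]
  rw [integral_finsetSum _ fun j hj =>
    hγ.integrableOn_transition (Finset.ne_of_mem_erase hj).symm ht]
  simp only [transitionTail, if_true, zero_add]
  exact Finset.sum_congr rfl fun j hj => if_neg (Finset.ne_of_mem_erase hj).symm

/-- A rate with divergent integral is not almost everywhere zero. Thus each state leads to every
other one in a single switch. -/
theorem IsHazardRates.transitionTail_zero_pos [Nontrivial D] (hγ : IsHazardRates γ) {i j : D}
    (hij : i ≠ j) : 0 < transitionTail γ i j 0 := by
  rw [transitionTail, if_neg hij]
  have hnn : ∀ u ∈ Ioi (0 : ℝ), 0 ≤ γ i j u * survival γ i u := fun u hu =>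
    mul_nonneg (hγ.nonneg i j hij u hu) (survival_pos γ i u).le
  refine lt_of_le_of_ne (setIntegral_nonneg measurableSet_Ioi hnn) fun h => ?_
  have h0 := (setIntegral_eq_zero_iff_of_nonneg_ae
    ((ae_restrict_iff' measurableSet_Ioi).2 (ae_of_all _ hnn))
    (hγ.integrableOn_transition hij le_rfl)).1 h.symm
  have hz : ∀ t, 0 ≤ t → ∫ u in (0 : ℝ)..t, γ i j u = 0 := by
    intro t ht
    rw [intervalIntegral.integral_of_le ht]
    refine integral_eq_zero_of_ae ?_
    filter_upwards [ae_restrict_of_ae_restrict_of_subset Ioc_subset_Ioi_self h0] with u hu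
    exact (mul_eq_zero.1 hu).resolve_right (survival_pos γ i u).ne'
  obtain ⟨t, ht0, ht⟩ := ((eventually_ge_atTop 0).and
    ((hγ.nonexploding i j hij).eventually_ge_atTop 1)).exists
  linarith [hz t ht0]

/-- The law of the holding time in the state `i`. -/
def holdingLaw (γ : D → D → ℝ → ℝ) (i : D) : Measure ℝ :=
  (volume.restrict (Ioi 0)).withDensity fun u =>
    ENNReal.ofReal (totalHazard γ i u * survival γ i u)

theorem IsHazardRates.holdingLaw_Ioi [Nontrivial D] (hγ : IsHazardRates γ) (i : D)
    {t : ℝ} (ht : 0 ≤ t) : holdingLaw γ i (Ioi t) = ENNReal.ofReal (survival γ i t) := by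
  rw [holdingLaw, withDensity_apply _ measurableSet_Ioi, Measure.restrict_restrict
    measurableSet_Ioi, inter_eq_self_of_subset_left (Ioi_subset_Ioi ht),
    ← ofReal_integral_eq_lintegral_ofReal (hγ.integrableOn_density i ht),
    hγ.integral_Ioi_density i ht]
  exact (ae_restrict_iff' measurableSet_Ioi).2
    (ae_of_all _ fun u hu => hγ.density_nonneg i (ht.trans_lt hu))

theorem holdingLaw_Iic_zero (γ : D → D → ℝ → ℝ) (i : D) : holdingLaw γ i (Iic 0) = 0 := by
  rw [holdingLaw, withDensity_apply _ measurableSet_Iic, Measure.restrict_restrict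
    measurableSet_Iic, Iic_inter_Ioi, Ioc_self, Measure.restrict_empty, lintegral_zero_measure]

theorem ae_holdingLaw_pos (γ : D → D → ℝ → ℝ) (i : D) : ∀ᵐ v ∂holdingLaw γ i, 0 < v := by
  rw [ae_iff]
  simpa [Iic] using! holdingLaw_Iic_zero γ i

theorem IsHazardRates.isProbabilityMeasure_holdingLaw [Nontrivial D] (hγ : IsHazardRates γ)
    (i : D) : IsProbabilityMeasure (holdingLaw γ i) := by
  constructor
  rw [← Iic_union_Ioi (a := (0 : ℝ)), measure_union (Iic_disjoint_Ioi le_rfl) measurableSet_Ioi,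
    holdingLaw_Iic_zero, hγ.holdingLaw_Ioi i le_rfl, survival_zero]
  simp

theorem IsHazardRates.lintegral_holdingLaw (hγ : IsHazardRates γ) (i : D) {f : ℝ → ℝ≥0∞}
    (hf : Measurable f) : ∫⁻ v, f v ∂holdingLaw γ i =
      ∫⁻ v in Ioi 0, ENNReal.ofReal (totalHazard γ i v * survival γ i v) * f v := by
  rw [holdingLaw, lintegral_withDensity_eq_lintegral_mul _ (hγ.measurable_density i).ennreal_ofReal
    hf]
  rfl

theorem IsHazardRates.integral_holdingLaw (hγ : IsHazardRates γ) (i : D) (f : ℝ → ℝ) :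
    ∫ v, f v ∂holdingLaw γ i =
      ∫ v in Ioi 0, totalHazard γ i v * survival γ i v * f v := by
  have h := integral_withDensity_eq_integral_toReal_smul (μ := volume.restrict (Ioi 0))
    (hγ.measurable_density i).ennreal_ofReal (ae_of_all _ fun _ => ENNReal.ofReal_lt_top) f
  rw [holdingLaw, h]
  refine setIntegral_congr_fun measurableSet_Ioi fun v hv => ?_
  simp only [smul_eq_mul]
  rw [ENNReal.toReal_ofReal (hγ.density_nonneg i hv)]

end Hazard

/-- A function of a random element `X` with finitely many values and of `ω` is measurable when it
is so for every value of `X`. -/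
theorem measurable_of_fiber [Finite D] {β : Type*} [MeasurableSpace β] {m : MeasurableSpace Ω}
    {X : Ω → D} (hX : ∀ i, MeasurableSet {ω | X ω = i}) {f : D → Ω → β}
    (hf : ∀ i, Measurable (f i)) : Measurable fun ω => f (X ω) ω := by
  intro A hA
  have hset : (fun ω => f (X ω) ω) ⁻¹' A = ⋃ i, {ω | X ω = i} ∩ f i ⁻¹' A := by
    ext ω; simp
  rw [hset]
  exact MeasurableSet.iUnion fun i => (hX i).inter (hf i hA)

/-! ### Path properties and measurability of the switching times -/

section Path

variable {ε : ℝ≥0 → Ω → D} {τ : ℕ → Ω → ℝ≥0}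

theorem IsSwitchingTimes.bddAbove (hτ : IsSwitchingTimes ε τ) (t : ℝ) (ω : Ω) :
    BddAbove {n | (τ n ω : ℝ) ≤ t} := by
  obtain ⟨N, hN⟩ := eventually_atTop.1 ((hτ.tendsto ω).eventually_gt_atTop t.toNNReal)
  refine ⟨N, fun n hn => le_of_not_gt fun h => ?_⟩
  exact absurd (NNReal.le_toNNReal_of_coe_le hn) (not_le.2 (hN n h.le))

theorem IsSwitchingTimes.coe_le_coe (hτ : IsSwitchingTimes ε τ) (ω : Ω) {m n : ℕ} (h : m ≤ n) :
    (τ m ω : ℝ) ≤ τ n ω := NNReal.coe_le_coe.2 ((hτ.strictMono ω).monotone h)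

theorem IsSwitchingTimes.le_count_iff (hτ : IsSwitchingTimes ε τ) {t : ℝ} (ht : 0 ≤ t) (ω : Ω)
    (n : ℕ) : n ≤ count τ t ω ↔ (τ n ω : ℝ) ≤ t := by
  refine ⟨fun h => ?_, fun h => le_csSup (hτ.bddAbove t ω) h⟩
  have h0 : (0 : ℕ) ∈ {n | (τ n ω : ℝ) ≤ t} := by simp [hτ.zero, ht]
  exact (hτ.coe_le_coe ω h).trans (Nat.sSup_mem ⟨0, h0⟩ (hτ.bddAbove t ω))

theorem IsSwitchingTimes.count_lt_iff (hτ : IsSwitchingTimes ε τ) {t : ℝ} (ht : 0 ≤ t) (ω : Ω)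
    (n : ℕ) : count τ t ω < n ↔ t < τ n ω := by
  rw [← not_le, hτ.le_count_iff ht, not_le]

theorem IsSwitchingTimes.count_eq_iff (hτ : IsSwitchingTimes ε τ) {t : ℝ} (ht : 0 ≤ t) (ω : Ω)
    (n : ℕ) : count τ t ω = n ↔ (τ n ω : ℝ) ≤ t ∧ t < τ (n + 1) ω := by
  rw [← hτ.le_count_iff ht, ← hτ.count_lt_iff ht]; omega

theorem IsSwitchingTimes.apply_eq (hτ : IsSwitchingTimes ε τ) {t : ℝ≥0} {ω : Ω} {n : ℕ}
    (h : τ n ω ≤ t) (h' : t < τ (n + 1) ω) : ε t ω = ε (τ n ω) ω := hτ.eq_of_mem ω n t ⟨h, h'⟩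

theorem IsSwitchingTimes.exists_mem (hτ : IsSwitchingTimes ε τ) (t : ℝ≥0) (ω : Ω) :
    ∃ n, τ n ω ≤ t ∧ t < τ (n + 1) ω :=
  ⟨count τ t ω, by exact_mod_cast (hτ.count_eq_iff t.2 ω _).1 rfl⟩

theorem IsSwitchingTimes.lt_succ (hτ : IsSwitchingTimes ε τ) (n : ℕ) (ω : Ω) :
    τ n ω < τ (n + 1) ω := hτ.strictMono ω n.lt_succ_self

/-- A countable set of sampling times up to `u`, containing `u`. -/
def sampleTimes (u : ℝ≥0) : Set ℝ≥0 :=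
  insert u (range (TopologicalSpace.denseSeq ℝ≥0) ∩ Iic u)

theorem countable_sampleTimes (u : ℝ≥0) : (sampleTimes u).Countable :=
  ((countable_range _).mono inter_subset_left).insert u

theorem le_of_mem_sampleTimes {u q : ℝ≥0} (hq : q ∈ sampleTimes u) : q ≤ u := by
  rcases hq with rfl | hq
  exacts [le_rfl, hq.2]

/-- When `r = u` there is no room to the right of `r` below `u`; this is why `u` itself is a
sampling time. -/
theorem exists_mem_sampleTimes {u r s : ℝ≥0} (hr : r ≤ u) (hs : r < s) :
    ∃ q ∈ sampleTimes u, r ≤ q ∧ q < s := by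
  rcases hr.eq_or_lt with rfl | hr
  · exact ⟨r, mem_insert _ _, le_rfl, hs⟩
  · obtain ⟨q, h1, h2⟩ := (TopologicalSpace.denseRange_denseSeq ℝ≥0).exists_mem_open
      (isOpen_Ioo (a := r) (b := min u s)) (nonempty_Ioo.2 (lt_min hr hs))
    exact ⟨_, Or.inr ⟨⟨q, rfl⟩, (h2.trans_le (min_le_left _ _)).le⟩, h1.le,
      h2.trans_le (min_le_right _ _)⟩

variable [MeasurableSpace D]

theorem past_mono (ε : ℝ≥0 → Ω → D) : Monotone (past ε) := fun _ _ hst =>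
  iSup_le fun r => iSup_le fun hr => le_iSup_of_le r (le_iSup_of_le (hr.trans hst) le_rfl)

theorem past_le_wholePath (ε : ℝ≥0 → Ω → D) (t : ℝ≥0) : past ε t ≤ wholePath ε :=
  iSup_mono fun _ => iSup_le fun _ => le_rfl

theorem measurable_past (ε : ℝ≥0 → Ω → D) {s t : ℝ≥0} (h : s ≤ t) : Measurable[past ε t] (ε s) :=
  Measurable.of_comap_le (le_iSup_of_le s (le_iSup_of_le h le_rfl))

theorem measurable_history_pair (ε : ℝ≥0 → Ω → D) (τ : ℕ → Ω → ℝ≥0) {k n : ℕ} (h : k ≤ n) :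
    Measurable[history ε τ n] fun ω => (τ k ω, ε (τ k ω) ω) :=
  Measurable.of_comap_le (le_iSup_of_le k (le_iSup_of_le h le_rfl))

theorem measurable_history_time (ε : ℝ≥0 → Ω → D) (τ : ℕ → Ω → ℝ≥0) {k n : ℕ} (h : k ≤ n) :
    Measurable[history ε τ n] (τ k) := measurable_fst.comp (measurable_history_pair ε τ h)

theorem measurable_history_state (ε : ℝ≥0 → Ω → D) (τ : ℕ → Ω → ℝ≥0) {k n : ℕ} (h : k ≤ n) :
    Measurable[history ε τ n] fun ω => ε (τ k ω) ω :=
  measurable_snd.comp (measurable_history_pair ε τ h)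

/-- Before `τ_{n+1}`, the past of `ε` carries no more information than
`τ₀, ε(τ₀), …, τ_n, ε(τ_n)`. -/
theorem IsSwitchingTimes.exists_history_set (hτ : IsSwitchingTimes ε τ) (n : ℕ) (s : ℝ≥0)
    {B : Set Ω} (hB : MeasurableSet[past ε s] B) :
    ∃ B', MeasurableSet[history ε τ n] B' ∧ ∀ ω, s < τ (n + 1) ω → (ω ∈ B ↔ ω ∈ B') := by
  -- The sets with the required property form a σ-algebra, so only the generators `{ε u ∈ A}` with
  -- `u ≤ s` need checking.
  let m' : MeasurableSpace Ω :=
    { MeasurableSet' := fun B => ∃ B', MeasurableSet[history ε τ n] B' ∧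
        ∀ ω, s < τ (n + 1) ω → (ω ∈ B ↔ ω ∈ B')
      measurableSet_empty := ⟨∅, @MeasurableSet.empty _ (history ε τ n), fun _ _ => Iff.rfl⟩
      measurableSet_compl := fun B ⟨B', h1, h2⟩ =>
        ⟨B'ᶜ, h1.compl, fun ω hω => not_congr (h2 ω hω)⟩
      measurableSet_iUnion := fun f hf => by
        choose g hg using hf
        refine ⟨⋃ k, g k, MeasurableSet.iUnion fun k => (hg k).1, fun ω hω => ?_⟩
        simp only [mem_iUnion]
        exact exists_congr fun k => (hg k).2 ω hω }
  refine (iSup_le fun u => iSup_le fun hu => ?_ : past ε s ≤ m') B hB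
  rintro _ ⟨A, hA, rfl⟩
  -- Split according to the cycle `k ≤ n` that contains `u`. For `k = n` the upper constraint `u <
  -- τ_{n+1}` is not known to the history, but it holds automatically since `u ≤ s < τ_{n+1}`.
  refine ⟨⋃ k ∈ Iic n, {ω | τ k ω ≤ u} ∩ {ω | k = n ∨ u < τ (k + 1) ω} ∩
    (fun ω => ε (τ k ω) ω) ⁻¹' A, ?_, fun ω hω => ?_⟩
  · refine MeasurableSet.biUnion (to_countable _) fun k hk => ?_
    refine MeasurableSet.inter (MeasurableSet.inter ?_ ?_) (measurable_history_state ε τ hk hA)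
    · exact measurable_history_time ε τ hk measurableSet_Iic
    · rcases eq_or_ne k n with h | h
      · simp [h]
      · simp only [h, false_or]
        exact measurable_history_time ε τ (Nat.succ_le_of_lt (lt_of_le_of_ne hk h))
          measurableSet_Ioi
  · simp only [mem_preimage, mem_iUnion, mem_inter_iff, mem_ofPred_eq, mem_Iic, exists_prop]
    obtain ⟨k, hk1, hk2⟩ := hτ.exists_mem u ω
    have hkn : k ≤ n := by
      by_contra! h
      exact absurd (((hτ.strictMono ω).monotone h).trans (hk1.trans hu)) (not_le.2 hω)
    constructor
    · intro h
      exact ⟨k, hkn, ⟨hk1, Or.inr hk2⟩, by rwa [← hτ.apply_eq hk1 hk2]⟩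
    · rintro ⟨l, hl, ⟨h1, h2⟩, h3⟩
      rwa [hτ.apply_eq h1]
      rcases h2 with rfl | h2
      exacts [hu.trans_lt hω, h2]

variable [MeasurableSingletonClass D]

theorem measurableSet_past_eq (ε : ℝ≥0 → Ω → D) {s t : ℝ≥0} (h : s ≤ t) (i : D) :
    MeasurableSet[past ε t] {ω | ε s ω = i} :=
  measurable_past ε h (measurableSet_singleton i)

theorem measurableSet_history_state (ε : ℝ≥0 → Ω → D) (τ : ℕ → Ω → ℝ≥0) (n : ℕ) (i : D) :
    MeasurableSet[history ε τ n] {ω | ε (τ n ω) ω = i} :=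
  measurable_history_state ε τ le_rfl (measurableSet_singleton i)

/-- By right-continuity, `ε(τ_n) = i` exactly when for some `m` all sampled values of `ε` in `[τ_n,
τ_n + 1/(m+1))` equal `i`. The stopping time property is a hypothesis so that the lemma can serve
inside the induction that proves it. -/
theorem IsSwitchingTimes.measurableSet_state_of_le (hτ : IsSwitchingTimes ε τ) {n : ℕ}
    (hn : ∀ u, MeasurableSet[past ε u] {ω | τ n ω ≤ u}) (u : ℝ≥0) (i : D) :
    MeasurableSet[past ε u] {ω | τ n ω ≤ u ∧ ε (τ n ω) ω = i} := by
  have hmem : ∀ (m : ℕ), ∀ q ∈ sampleTimes u, MeasurableSet[past ε u]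
      {ω | τ n ω ≤ q ∧ q < τ n ω + 1 / ((m : ℝ≥0) + 1) → ε q ω = i} := by
    intro m q hq
    have hle : MeasurableSet[past ε u] {ω | τ n ω ≤ q} :=
      past_mono ε (le_of_mem_sampleTimes hq) _ (hn q)
    have hlt : MeasurableSet[past ε u] {ω | q < τ n ω + 1 / ((m : ℝ≥0) + 1)} := by
      -- Subtraction in `ℝ≥0` is truncated: the condition becomes one on `τ_n` only if `1/(m+1) ≤
      -- q`, and otherwise it always holds.
      rcases le_or_gt (1 / ((m : ℝ≥0) + 1)) q with h | h
      · have : {ω | q < τ n ω + 1 / ((m : ℝ≥0) + 1)} = {ω | τ n ω ≤ q - 1 / ((m : ℝ≥0) + 1)}ᶜ := by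
          ext ω
          simp only [mem_ofPred_eq, mem_compl_iff, not_le]
          rw [tsub_lt_iff_right h]
        rw [this]
        exact (past_mono ε (tsub_le_self.trans (le_of_mem_sampleTimes hq)) _ (hn _)).compl
      · have : {ω | q < τ n ω + 1 / ((m : ℝ≥0) + 1)} = univ :=
          eq_univ_of_forall fun ω => h.trans_le le_add_self
        rw [this]; exact MeasurableSet.univ
    have hset : {ω | τ n ω ≤ q ∧ q < τ n ω + 1 / ((m : ℝ≥0) + 1) → ε q ω = i} =
        ({ω | τ n ω ≤ q} ∩ {ω | q < τ n ω + 1 / ((m : ℝ≥0) + 1)})ᶜ ∪ {ω | ε q ω = i} := by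
      ext ω
      simp only [mem_ofPred_eq, mem_union, mem_compl_iff, mem_inter_iff]
      tauto
    rw [hset]
    exact (hle.inter hlt).compl.union
      (measurableSet_past_eq ε (le_of_mem_sampleTimes hq) i)
  have hset : {ω | τ n ω ≤ u ∧ ε (τ n ω) ω = i} = {ω | τ n ω ≤ u} ∩
      ⋃ m : ℕ, ⋂ q ∈ sampleTimes u,
        {ω | τ n ω ≤ q ∧ q < τ n ω + 1 / ((m : ℝ≥0) + 1) → ε q ω = i} := by
    ext ω
    simp only [mem_ofPred_eq, mem_inter_iff, mem_iUnion, mem_iInter]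
    refine and_congr_right fun hu => ⟨fun hi => ?_, fun ⟨m, hm⟩ => ?_⟩
    · obtain ⟨m, hm⟩ := exists_nat_one_div_lt (tsub_pos_of_lt (hτ.lt_succ n ω))
      refine ⟨m, fun q _ hq => ?_⟩
      rw [hτ.apply_eq hq.1 (hq.2.trans ?_), hi]
      rw [add_comm]
      exact lt_tsub_iff_right.1 hm
    · obtain ⟨q, hq, h1, h2⟩ := exists_mem_sampleTimes hu
        (lt_min (hτ.lt_succ n ω) (lt_add_of_pos_right (τ n ω)
          (by positivity : 0 < 1 / ((m : ℝ≥0) + 1))))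
      rw [← hτ.apply_eq h1 (h2.trans_le (min_le_left _ _))]
      exact hm q hq ⟨h1, h2.trans_le (min_le_right _ _)⟩
  rw [hset]
  exact (hn u).inter (MeasurableSet.iUnion fun m =>
    MeasurableSet.biInter (countable_sampleTimes u) (hmem m))

variable [Fintype D]

/-- The switching times are stopping times of the past of `ε`, by induction: `τ_{n+1} ≤ u` means
that at some sampling time after `τ_n` the process has left `ε(τ_n)`. -/
theorem IsSwitchingTimes.measurableSet_le (hτ : IsSwitchingTimes ε τ) (n : ℕ) (u : ℝ≥0) :
    MeasurableSet[past ε u] {ω | τ n ω ≤ u} := by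
  induction n generalizing u with
  | zero => simp [hτ.zero]
  | succ n ih =>
    have hset : {ω | τ (n + 1) ω ≤ u} = ⋃ q ∈ sampleTimes u, ⋃ i : D,
        {ω | τ n ω ≤ q ∧ ε (τ n ω) ω = i} ∩ {ω | ε q ω = i}ᶜ := by
      ext ω
      simp only [mem_ofPred_eq, mem_iUnion, mem_inter_iff, mem_compl_iff, exists_prop]
      constructor
      · intro h
        -- A sampling time in `[τ_{n+1}, τ_{n+2})`: a later one could fall after a return to the old
        -- state.
        obtain ⟨q, hq, h1, h2⟩ := exists_mem_sampleTimes h (hτ.lt_succ (n + 1) ω)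
        refine ⟨q, hq, _, ⟨(hτ.lt_succ n ω).le.trans h1, rfl⟩, ?_⟩
        rw [hτ.apply_eq h1 h2]
        exact hτ.switch ω n
      · rintro ⟨q, hq, i, ⟨h1, rfl⟩, h2⟩
        refine (le_of_not_gt fun h => h2 (hτ.apply_eq h1 h)).trans (le_of_mem_sampleTimes hq)
    rw [hset]
    refine MeasurableSet.biUnion (countable_sampleTimes u) fun q hq =>
      MeasurableSet.iUnion fun i => ?_
    exact (past_mono ε (le_of_mem_sampleTimes hq) _ (hτ.measurableSet_state_of_le ih q i)).inter
      (measurableSet_past_eq ε (le_of_mem_sampleTimes hq) i).compl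

theorem IsSwitchingTimes.measurableSet_state (hτ : IsSwitchingTimes ε τ) (n : ℕ) (u : ℝ≥0)
    (i : D) : MeasurableSet[past ε u] {ω | τ n ω ≤ u ∧ ε (τ n ω) ω = i} :=
  hτ.measurableSet_state_of_le (hτ.measurableSet_le n) u i

theorem IsSwitchingTimes.measurable_min (hτ : IsSwitchingTimes ε τ) (n : ℕ) (u : ℝ≥0) :
    Measurable[past ε u] fun ω => (min (τ n ω) u : ℝ≥0) := by
  refine measurable_of_Iic (mδ := past ε u) fun v => ?_
  rcases le_or_gt u v with h | h
  · have : (fun ω => min (τ n ω) u) ⁻¹' Iic v = univ :=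
      eq_univ_of_forall fun ω => (min_le_right _ _).trans h
    rw [this]; exact MeasurableSet.univ
  · have : (fun ω => min (τ n ω) u) ⁻¹' Iic v = {ω | τ n ω ≤ v} := by
      ext ω; simp [h.not_ge]
    rw [this]
    exact past_mono ε h.le _ (hτ.measurableSet_le n v)

theorem IsSwitchingTimes.measurable_real_min (hτ : IsSwitchingTimes ε τ) (n : ℕ) (u : ℝ≥0) :
    Measurable[past ε u] fun ω => min (τ n ω : ℝ) u := by
  simpa using! measurable_coe_nnreal_real.comp (hτ.measurable_min n u)

/-- Case distinction on the state `ε(τ_n)` is measurable on `{τ_n ≤ u}`. -/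
theorem IsSwitchingTimes.measurable_ite (hτ : IsSwitchingTimes ε τ) (n : ℕ) (u : ℝ≥0)
    {f : D → Ω → ℝ} (hf : ∀ i, Measurable[past ε u] (f i)) :
    Measurable[past ε u] fun ω => if τ n ω ≤ u then f (ε (τ n ω) ω) ω else 0 := by
  have hsum : (fun ω => if τ n ω ≤ u then f (ε (τ n ω) ω) ω else 0) =
      fun ω => ∑ i, {ω | τ n ω ≤ u ∧ ε (τ n ω) ω = i}.indicator (f i) ω := by
    ext ω
    rw [Finset.sum_eq_single (ε (τ n ω) ω)]
    · simp [indicator]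
    · intro i _ hi
      exact indicator_of_notMem (fun h => hi h.2.symm) _
    · simp
  rw [hsum]
  refine Finset.measurable_fun_sum (m := past ε u) _ fun i _ => ?_
  exact (hf i).indicator (hτ.measurableSet_state n u i)

theorem IsSwitchingTimes.measurable_state (hτ : IsSwitchingTimes ε τ) (n : ℕ) :
    Measurable[wholePath ε] fun ω => ε (τ n ω) ω := by
  refine @measurable_to_countable' _ _ _ _ (wholePath ε) _ fun i => ?_
  have : (fun ω => ε (τ n ω) ω) ⁻¹' {i} = ⋃ m : ℕ, {ω | τ n ω ≤ m ∧ ε (τ n ω) ω = i} := by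
    ext ω
    simp only [mem_preimage, mem_singleton_iff, mem_iUnion, mem_ofPred_eq, exists_and_right,
      iff_and_self]
    exact fun _ => exists_nat_ge (τ n ω)
  rw [this]
  exact MeasurableSet.iUnion fun m => past_le_wholePath ε m _ (hτ.measurableSet_state n m i)

end Path

/-! ### The Markov renewal property in integrated form -/

section Renewal

theorem setIntegral_eq_sum_fiber {α : Type*} {mα : MeasurableSpace α} {μ : Measure α} [Fintype D]
    {X : α → D} (hX : ∀ i, MeasurableSet {a | X a = i}) {f : α → ℝ} (hf : Integrable f μ)
    (B : Set α) (hB : MeasurableSet B) :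
    ∫ a in B, f a ∂μ = ∑ i, ∫ a in B ∩ {a | X a = i}, f a ∂μ := by
  rw [← integral_iUnion_fintype (fun i => hB.inter (hX i)) _ fun i => hf.integrableOn]
  · congr 2
    ext a; simp
  · intro i j hij
    exact disjoint_left.2 fun a ha hb => hij (ha.2.symm.trans hb.2)

theorem setLIntegral_eq_sum_fiber {α : Type*} {mα : MeasurableSpace α} {μ : Measure α} [Fintype D]
    {X : α → D} (hX : ∀ i, MeasurableSet {a | X a = i}) (f : α → ℝ≥0∞)
    (B : Set α) (hB : MeasurableSet B) :
    ∫⁻ a in B, f a ∂μ = ∑ i, ∫⁻ a in B ∩ {a | X a = i}, f a ∂μ := by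
  rw [← tsum_fintype (L := SummationFilter.unconditional _), ← lintegral_iUnion (fun i => hB.inter (hX i))]
  · congr 2
    ext a; simp
  · intro i j hij
    exact disjoint_left.2 fun a ha hb => hij (ha.2.symm.trans hb.2)

/-- The holding time `τ_{n+1} - τ_n`. -/
def holdingTime (τ : ℕ → Ω → ℝ≥0) (n : ℕ) (ω : Ω) : ℝ := (τ (n + 1) ω : ℝ) - τ n ω

theorem IsSwitchingTimes.holdingTime_pos {ε : ℝ≥0 → Ω → D} {τ : ℕ → Ω → ℝ≥0}
    (hτ : IsSwitchingTimes ε τ) (n : ℕ) (ω : Ω) : 0 < holdingTime τ n ω :=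
  sub_pos.2 (NNReal.coe_lt_coe.2 (hτ.lt_succ n ω))

variable [Fintype D] [DecidableEq D] [Nontrivial D] [MeasurableSpace D]
  [MeasurableSingletonClass D] {mΩ : MeasurableSpace Ω} {P : Measure Ω} [IsProbabilityMeasure P]
  {ℱ : Filtration ℝ≥0 mΩ} {γ : D → D → ℝ → ℝ} {ε : ℝ≥0 → Ω → D} {τ : ℕ → Ω → ℝ≥0}

omit [Nontrivial D] [MeasurableSingletonClass D] [IsProbabilityMeasure P] in
theorem IsSemiMarkov.past_le (hε : IsSemiMarkov P ℱ γ ε τ) (t : ℝ≥0) : past ε t ≤ ℱ t :=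
  iSup_le fun s => iSup_le fun hs => ((hε.adapted s).mono (ℱ.mono hs) le_rfl).comap_le

omit [Nontrivial D] [MeasurableSingletonClass D] [IsProbabilityMeasure P] in
theorem IsSemiMarkov.wholePath_le (hε : IsSemiMarkov P ℱ γ ε τ) : wholePath ε ≤ mΩ :=
  iSup_le fun s => ((hε.adapted s).mono (ℱ.le s) le_rfl).comap_le

omit [Nontrivial D] [IsProbabilityMeasure P] in
theorem IsSemiMarkov.measurable_state (hε : IsSemiMarkov P ℱ γ ε τ) (n : ℕ) :
    Measurable fun ω => ε (τ n ω) ω :=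
  (hε.switchingTimes.measurable_state n).mono hε.wholePath_le le_rfl

omit [Nontrivial D] [IsProbabilityMeasure P] in
theorem IsSemiMarkov.measurableSet_state (hε : IsSemiMarkov P ℱ γ ε τ) (n : ℕ) (i : D) :
    MeasurableSet {ω | ε (τ n ω) ω = i} := hε.measurable_state n (measurableSet_singleton i)

omit [Nontrivial D] [IsProbabilityMeasure P] in
theorem IsSemiMarkov.history_le (hε : IsSemiMarkov P ℱ γ ε τ) (n : ℕ) : history ε τ n ≤ mΩ :=
  iSup_le fun k => iSup_le fun _ =>
    ((hε.measurable_time k).prodMk (hε.measurable_state k)).comap_le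

omit [Nontrivial D] [MeasurableSingletonClass D] [IsProbabilityMeasure P] in
theorem IsSemiMarkov.measurable_holdingTime (hε : IsSemiMarkov P ℱ γ ε τ) (n : ℕ) :
    Measurable (holdingTime τ n) :=
  (measurable_coe_nnreal_real.comp (hε.measurable_time (n + 1))).sub
    (measurable_coe_nnreal_real.comp (hε.measurable_time n))

omit [Nontrivial D] in
theorem IsSemiMarkov.measureReal_transition (hε : IsSemiMarkov P ℱ γ ε τ) (n : ℕ) (i j : D)
    {B : Set Ω} (hB : MeasurableSet[history ε τ n] B) {t : ℝ} (ht : 0 ≤ t) :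
    P.real (B ∩ {ω | ε (τ n ω) ω = i} ∩
      {ω | t < holdingTime τ n ω ∧ ε (τ (n + 1) ω) ω = j}) =
      P.real (B ∩ {ω | ε (τ n ω) ω = i}) * transitionTail γ i j t := by
  set E : Set Ω := {ω | t < holdingTime τ n ω ∧ ε (τ (n + 1) ω) ω = j} with hE
  have hEm : MeasurableSet E := (measurableSet_lt measurable_const
    (hε.measurable_holdingTime n)).inter (hε.measurableSet_state (n + 1) j)
  have hBi : MeasurableSet[history ε τ n] (B ∩ {ω | ε (τ n ω) ω = i}) :=
    hB.inter (measurableSet_history_state ε τ n i)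
  have hBi' := hε.history_le n _ hBi
  have h1 := setIntegral_condExp (μ := P) (f := E.indicator fun _ => (1 : ℝ)) (hε.history_le n)
    ((integrable_const 1).indicator hEm) hBi
  have h2 : ∫ ω in B ∩ {ω | ε (τ n ω) ω = i}, (P⟦E | history ε τ n⟧) ω ∂P =
      ∫ ω in B ∩ {ω | ε (τ n ω) ω = i}, transitionTail γ i j t ∂P := by
    refine setIntegral_congr_ae hBi' ?_
    filter_upwards [hε.renewal n j t ht] with ω hω hωB
    rw [← hωB.2]
    exact hω
  rw [h2, setIntegral_const, setIntegral_indicator hEm, setIntegral_const] at h1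
  simpa using h1.symm

theorem IsSemiMarkov.measure_Ioi (hγ : IsHazardRates γ) (hε : IsSemiMarkov P ℱ γ ε τ) (n : ℕ)
    (i : D) {B : Set Ω} (hB : MeasurableSet[history ε τ n] B) {t : ℝ} (ht : 0 ≤ t) :
    P (B ∩ {ω | ε (τ n ω) ω = i} ∩ {ω | t < holdingTime τ n ω}) =
      P (B ∩ {ω | ε (τ n ω) ω = i}) * ENNReal.ofReal (survival γ i t) := by
  have hBi' := hε.history_le n _ (hB.inter (measurableSet_history_state ε τ n i))
  have hTm : MeasurableSet {ω | t < holdingTime τ n ω} :=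
    measurableSet_lt measurable_const (hε.measurable_holdingTime n)
  have h1 := setIntegral_eq_sum_fiber (hε.measurableSet_state (n + 1)) (integrable_const (1 : ℝ))
    (B ∩ {ω | ε (τ n ω) ω = i} ∩ {ω | t < holdingTime τ n ω}) (hBi'.inter hTm) (μ := P)
  simp only [setIntegral_const, smul_eq_mul, mul_one] at h1
  have h2 : ∀ j, P.real (B ∩ {ω | ε (τ n ω) ω = i} ∩ {ω | t < holdingTime τ n ω} ∩
      {ω | ε (τ (n + 1) ω) ω = j}) =
      P.real (B ∩ {ω | ε (τ n ω) ω = i}) * transitionTail γ i j t := fun j => by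
    rw [← hε.measureReal_transition n i j hB ht, inter_assoc]
    rfl
  simp_rw [h2] at h1
  rw [← Finset.mul_sum, hγ.sum_transitionTail i ht] at h1
  refine (ENNReal.toReal_eq_toReal_iff' (measure_ne_top _ _)
    (ENNReal.mul_ne_top (measure_ne_top _ _) ENNReal.ofReal_ne_top)).1 ?_
  rw [ENNReal.toReal_mul, ENNReal.toReal_ofReal (survival_pos γ i t).le]
  exact h1

/-- Both measures have the same finite mass and, by `measure_Ioi`, the same tails. As `B` is
arbitrary, this says that given `ε(τ_n) = i` the holding time is independent of the history. -/
theorem IsSemiMarkov.map_holdingTime (hγ : IsHazardRates γ) (hε : IsSemiMarkov P ℱ γ ε τ) (n : ℕ)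
    (i : D) {B : Set Ω} (hB : MeasurableSet[history ε τ n] B) :
    (P.restrict (B ∩ {ω | ε (τ n ω) ω = i})).map (holdingTime τ n) =
      P (B ∩ {ω | ε (τ n ω) ω = i}) • holdingLaw γ i := by
  have := hγ.isProbabilityMeasure_holdingLaw i
  have hT := hε.measurable_holdingTime n
  have huniv : (P.restrict (B ∩ {ω | ε (τ n ω) ω = i})).map (holdingTime τ n) univ =
      P (B ∩ {ω | ε (τ n ω) ω = i}) := by
    rw [Measure.map_apply hT MeasurableSet.univ]; simp
  refine Measure.ext_of_Iic _ _ fun t => ?_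
  rw [← compl_Ioi, measure_compl measurableSet_Ioi (measure_ne_top _ _), huniv,
    Measure.smul_apply, prob_compl_eq_one_sub measurableSet_Ioi, smul_eq_mul,
    ENNReal.mul_sub (fun _ _ => measure_ne_top _ _), mul_one,
    Measure.map_apply hT measurableSet_Ioi,
    Measure.restrict_apply (hT measurableSet_Ioi), inter_comm (holdingTime τ n ⁻¹' Ioi t)]
  congr 1
  rcases le_or_gt 0 t with ht | ht
  · rw [hγ.holdingLaw_Ioi i ht, ← hε.measure_Ioi hγ n i hB ht]
    rfl
  · have h1 : holdingLaw γ i (Ioi t) = 1 := by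
      refine le_antisymm prob_le_one ?_
      rw [← show holdingLaw γ i (Ioi 0) = 1 by
        rw [hγ.holdingLaw_Ioi i le_rfl, survival_zero, ENNReal.ofReal_one]]
      exact measure_mono (Ioi_subset_Ioi ht.le)
    rw [h1, mul_one, inter_eq_left.2]
    exact fun ω _ => ht.trans (hε.switchingTimes.holdingTime_pos n ω)

/-- On rectangles this is `map_holdingTime` with `B` replaced by its intersection with an event on
`τ_n`, which belongs to the history. -/
theorem IsSemiMarkov.map_time_holdingTime (hγ : IsHazardRates γ) (hε : IsSemiMarkov P ℱ γ ε τ)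
    (n : ℕ) (i : D) {B : Set Ω} (hB : MeasurableSet[history ε τ n] B) :
    (P.restrict (B ∩ {ω | ε (τ n ω) ω = i})).map (fun ω => (τ n ω, holdingTime τ n ω)) =
      ((P.restrict (B ∩ {ω | ε (τ n ω) ω = i})).map (τ n)).prod (holdingLaw γ i) := by
  have := hγ.isProbabilityMeasure_holdingLaw i
  have hT := hε.measurable_holdingTime n
  have hτm := hε.measurable_time n
  symm
  refine Measure.prod_eq fun s A hs hA => ?_
  rw [Measure.map_apply (hτm.prodMk hT) (hs.prod hA), Measure.map_apply hτm hs,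
    Measure.restrict_apply (hτm hs), mk_preimage_prod,
    Measure.restrict_apply ((hτm hs).inter (hT hA))]
  have h := hε.map_holdingTime hγ n i
    (hB.inter (measurable_history_time ε τ le_rfl hs : MeasurableSet[history ε τ n] (τ n ⁻¹' s)))
  have h' := congrArg (fun μ : Measure ℝ => μ A) h
  simp only [Measure.map_apply hT hA, Measure.restrict_apply (hT hA), Measure.smul_apply,
    smul_eq_mul] at h'
  convert h' using 2
  · ext ω; simp only [mem_inter_iff]; tauto
  · congr 1
    ext ω; simp only [mem_inter_iff]; tauto

/-- Given the history up to `τ_n`, the holding time has the law attached to the state `ε(τ_n)`. -/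
theorem IsSemiMarkov.setLIntegral_renewal (hγ : IsHazardRates γ) (hε : IsSemiMarkov P ℱ γ ε τ)
    (n : ℕ) {B : Set Ω} (hB : MeasurableSet[history ε τ n] B) {g : D → ℝ≥0 → ℝ → ℝ≥0∞}
    (hg : ∀ i, Measurable (Function.uncurry (g i))) :
    ∫⁻ ω in B, g (ε (τ n ω) ω) (τ n ω) (holdingTime τ n ω) ∂P =
      ∫⁻ ω in B, ∫⁻ v, g (ε (τ n ω) ω) (τ n ω) v ∂holdingLaw γ (ε (τ n ω) ω) ∂P := by
  have hB' := hε.history_le n _ hB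
  rw [setLIntegral_eq_sum_fiber (hε.measurableSet_state n) _ B hB',
    setLIntegral_eq_sum_fiber (hε.measurableSet_state n) _ B hB']
  refine Finset.sum_congr rfl fun i _ => ?_
  have := hγ.isProbabilityMeasure_holdingLaw i
  have hBi := hB'.inter (hε.measurableSet_state n i)
  have hT := hε.measurable_holdingTime n
  have hτm := hε.measurable_time n
  calc ∫⁻ ω in B ∩ {ω | ε (τ n ω) ω = i}, g (ε (τ n ω) ω) (τ n ω) (holdingTime τ n ω) ∂P
      = ∫⁻ ω in B ∩ {ω | ε (τ n ω) ω = i},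
          Function.uncurry (g i) (τ n ω, holdingTime τ n ω) ∂P := by
        refine setLIntegral_congr_fun hBi fun ω hω => ?_
        rw [show ε (τ n ω) ω = i from hω.2]; rfl
    _ = ∫⁻ ω in B ∩ {ω | ε (τ n ω) ω = i}, ∫⁻ v, g i (τ n ω) v ∂holdingLaw γ i ∂P := by
        rw [← lintegral_map (hg i) (hτm.prodMk hT), hε.map_time_holdingTime hγ n i hB,
          lintegral_prod _ (hg i).aemeasurable,
          lintegral_map (hg i).lintegral_prod_right' hτm]
        rfl
    _ = _ := by
        refine setLIntegral_congr_fun hBi fun ω hω => ?_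
        rw [show ε (τ n ω) ω = i from hω.2]

theorem IsSemiMarkov.setIntegral_renewal_eq_zero (hγ : IsHazardRates γ)
    (hε : IsSemiMarkov P ℱ γ ε τ)
    (n : ℕ) {B : Set Ω} (hB : MeasurableSet[history ε τ n] B) {g : D → ℝ≥0 → ℝ → ℝ}
    (hg : ∀ i, Measurable (Function.uncurry (g i)))
    (hint : Integrable (fun ω => g (ε (τ n ω) ω) (τ n ω) (holdingTime τ n ω)) P)
    (h0 : ∀ i r, ∫ v, g i r v ∂holdingLaw γ i = 0) :
    ∫ ω in B, g (ε (τ n ω) ω) (τ n ω) (holdingTime τ n ω) ∂P = 0 := by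
  have hB' := hε.history_le n _ hB
  rw [setIntegral_eq_sum_fiber (hε.measurableSet_state n) hint B hB']
  refine Finset.sum_eq_zero fun i _ => ?_
  have := hγ.isProbabilityMeasure_holdingLaw i
  have hBi := hB'.inter (hε.measurableSet_state n i)
  have hT := hε.measurable_holdingTime n
  have hτm := hε.measurable_time n
  have hcongr : EqOn (fun ω => g (ε (τ n ω) ω) (τ n ω) (holdingTime τ n ω))
      (fun ω => Function.uncurry (g i) (τ n ω, holdingTime τ n ω))
      (B ∩ {ω | ε (τ n ω) ω = i}) := by
    intro ω hω
    simp only [Function.uncurry]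
    rw [show ε (τ n ω) ω = i from hω.2]
  have hint' := (integrableOn_congr_fun hcongr hBi).1 hint.integrableOn
  have hmap := hε.map_time_holdingTime hγ n i hB
  rw [setIntegral_congr_fun hBi hcongr, ← integral_map (hτm.prodMk hT).aemeasurable
    (hg i).aestronglyMeasurable, hmap, integral_prod]
  · simp [Function.uncurry, h0]
  · rw [← hmap]
    exact (integrable_map_measure (hg i).aestronglyMeasurable (hτm.prodMk hT).aemeasurable).2 hint'

/-- The factorisation for events of the history is an equality of measures trimmed to the history,
and so passes to functions measurable with respect to it. -/
theorem IsSemiMarkov.setLIntegral_survive (hγ : IsHazardRates γ)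
    (hε : IsSemiMarkov P ℱ γ ε τ) (n : ℕ) (i : D) {W : Ω → ℝ≥0∞}
    (hW : Measurable[history ε τ n] W) {t : ℝ} (ht : 0 ≤ t) :
    ∫⁻ ω in {ω | ε (τ n ω) ω = i} ∩ {ω | t < holdingTime τ n ω}, W ω ∂P =
      ENNReal.ofReal (survival γ i t) * ∫⁻ ω in {ω | ε (τ n ω) ω = i}, W ω ∂P := by
  have hG := hε.history_le n
  have htrim : (P.restrict ({ω | ε (τ n ω) ω = i} ∩ {ω | t < holdingTime τ n ω})).trim hG =
      ENNReal.ofReal (survival γ i t) • (P.restrict {ω | ε (τ n ω) ω = i}).trim hG := by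
    refine @Measure.ext _ (history ε τ n) _ _ fun B hB => ?_
    rw [trim_measurableSet_eq hG hB, Measure.smul_apply, trim_measurableSet_eq hG hB,
      Measure.restrict_apply (hG _ hB), Measure.restrict_apply (hG _ hB), ← inter_assoc,
      hε.measure_Ioi hγ n i hB ht, smul_eq_mul, mul_comm]
  rw [← lintegral_trim hG hW, ← lintegral_trim hG hW, htrim, lintegral_smul_measure, smul_eq_mul]

end Renewal

/-! ### Tail bounds for the number of switches -/

section Tail

theorem tsum_odd_mul_pow_ne_top {ρ : ℝ≥0∞} (hρ : ρ < 1) :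
    ∑' n : ℕ, (2 * (n : ℝ≥0∞) + 1) * ρ ^ n ≠ ⊤ := by
  lift ρ to ℝ≥0 using (hρ.trans ENNReal.one_lt_top).ne
  have hρ' : ‖(ρ : ℝ)‖ < 1 := by
    rw [Real.norm_of_nonneg (NNReal.coe_nonneg ρ)]; exact_mod_cast hρ
  have h1 := (summable_pow_mul_geometric_of_norm_lt_one 1 hρ').mul_left 2
  have h2 := h1.add (summable_geometric_of_norm_lt_one hρ')
  have h3 : Summable fun n : ℕ => (2 * (n : ℝ≥0) + 1) * ρ ^ n := by
    rw [← NNReal.summable_coe]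
    refine h2.congr fun n => ?_
    push_cast
    ring
  convert ENNReal.tsum_coe_ne_top_iff_summable.2 h3 using 3
  push_cast
  rfl

variable [Fintype D] [DecidableEq D] [Nontrivial D] {γ : D → D → ℝ → ℝ}

/-- Holding times are almost surely positive, so each Laplace transform at 1 is below 1; finitely
many states allow a common bound. -/
theorem IsHazardRates.exists_laplace_lt_one (hγ : IsHazardRates γ) :
    ∃ ρ : ℝ≥0∞, ρ < 1 ∧ ∀ i, ∫⁻ v, ENNReal.ofReal (Real.exp (-v)) ∂holdingLaw γ i ≤ ρ := by
  refine ⟨Finset.univ.sup fun i => ∫⁻ v, ENNReal.ofReal (Real.exp (-v)) ∂holdingLaw γ i, ?_,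
    fun i => Finset.le_sup (f := fun i => ∫⁻ v, ENNReal.ofReal (Real.exp (-v)) ∂holdingLaw γ i)
      (Finset.mem_univ i)⟩
  refine (Finset.sup_lt_iff (by simp)).2 fun i _ => ?_
  have := hγ.isProbabilityMeasure_holdingLaw i
  have hlt : ∀ᵐ v ∂holdingLaw γ i, ENNReal.ofReal (Real.exp (-v)) < 1 := by
    filter_upwards [ae_holdingLaw_pos γ i] with v hv
    rw [← ENNReal.ofReal_one]
    exact (ENNReal.ofReal_lt_ofReal_iff one_pos).2 (by simpa using hv)
  have hle : ∫⁻ v, ENNReal.ofReal (Real.exp (-v)) ∂holdingLaw γ i ≤ 1 := by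
    simpa using lintegral_mono_ae (hlt.mono fun v hv => hv.le)
  simpa using lintegral_strict_mono (IsProbabilityMeasure.ne_zero _) aemeasurable_const
    (ne_top_of_le_ne_top ENNReal.one_ne_top hle) hlt

variable [MeasurableSpace D] [MeasurableSingletonClass D] {mΩ : MeasurableSpace Ω}
  {P : Measure Ω} [IsProbabilityMeasure P] {ℱ : Filtration ℝ≥0 mΩ} {ε : ℝ≥0 → Ω → D}
  {τ : ℕ → Ω → ℝ≥0}

theorem IsSemiMarkov.lintegral_exp_neg_time_le (hγ : IsHazardRates γ)
    (hε : IsSemiMarkov P ℱ γ ε τ) {ρ : ℝ≥0∞}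
    (hρ : ∀ i, ∫⁻ v, ENNReal.ofReal (Real.exp (-v)) ∂holdingLaw γ i ≤ ρ) (n : ℕ) :
    ∫⁻ ω, ENNReal.ofReal (Real.exp (-(τ n ω : ℝ))) ∂P ≤ ρ ^ n := by
  have hexp : Measurable fun v : ℝ => ENNReal.ofReal (Real.exp (-v)) :=
    (Real.measurable_exp.comp measurable_neg).ennreal_ofReal
  induction n with
  | zero => simp [hε.switchingTimes.zero]
  | succ n ih =>
    have h := hε.setLIntegral_renewal hγ n (B := univ) MeasurableSet.univ
      (g := fun _ r v => ENNReal.ofReal (Real.exp (-(r : ℝ))) * ENNReal.ofReal (Real.exp (-v)))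
      (fun i => ((hexp.comp measurable_coe_nnreal_real).comp measurable_fst).mul
        (hexp.comp measurable_snd))
    simp only [Measure.restrict_univ] at h
    calc ∫⁻ ω, ENNReal.ofReal (Real.exp (-(τ (n + 1) ω : ℝ))) ∂P
        = ∫⁻ ω, ENNReal.ofReal (Real.exp (-(τ n ω : ℝ))) *
            ENNReal.ofReal (Real.exp (-holdingTime τ n ω)) ∂P := by
          refine lintegral_congr fun ω => ?_
          rw [← ENNReal.ofReal_mul (Real.exp_pos _).le, ← Real.exp_add, holdingTime]
          congr 2; ring
      _ ≤ ∫⁻ ω, ENNReal.ofReal (Real.exp (-(τ n ω : ℝ))) * ρ ∂P := by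
          rw [h]
          refine lintegral_mono fun ω => ?_
          simp only
          rw [lintegral_const_mul _ hexp]
          gcongr
          exact hρ _
      _ ≤ ρ ^ (n + 1) := by
          have hm : Measurable fun ω => ENNReal.ofReal (Real.exp (-(τ n ω : ℝ))) :=
            hexp.comp (measurable_coe_nnreal_real.comp (hε.measurable_time n))
          rw [lintegral_mul_const _ hm, pow_succ]
          gcongr

/-- By Markov's inequality for `exp (-τ_n)`, `P(τ_n ≤ t)` decays geometrically. The weights `2n + 1`
sum to squares, so the series also controls the second moment of `N(t)`. -/
theorem IsSemiMarkov.tsum_measure_le_ne_top (hγ : IsHazardRates γ)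
    (hε : IsSemiMarkov P ℱ γ ε τ) (t : ℝ≥0) :
    ∑' n : ℕ, (2 * (n : ℝ≥0∞) + 1) * P {ω | τ n ω ≤ t} ≠ ⊤ := by
  obtain ⟨ρ, hρ1, hρ⟩ := hγ.exists_laplace_lt_one
  have hexp : Measurable fun v : ℝ => ENNReal.ofReal (Real.exp (-v)) :=
    (Real.measurable_exp.comp measurable_neg).ennreal_ofReal
  have htail : ∀ n, P {ω | τ n ω ≤ t} ≤ ENNReal.ofReal (Real.exp t) * ρ ^ n := by
    intro n
    have hm : MeasurableSet {ω | τ n ω ≤ t} := hε.measurable_time n measurableSet_Iic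
    calc P {ω | τ n ω ≤ t} = ∫⁻ ω in {ω | τ n ω ≤ t}, 1 ∂P := (setLIntegral_one _).symm
      _ ≤ ∫⁻ ω in {ω | τ n ω ≤ t}, ENNReal.ofReal (Real.exp t) *
            ENNReal.ofReal (Real.exp (-(τ n ω : ℝ))) ∂P := by
          refine setLIntegral_mono' hm fun ω hω => ?_
          rw [← ENNReal.ofReal_mul (Real.exp_pos _).le, ← Real.exp_add, ENNReal.one_le_ofReal,
            Real.one_le_exp_iff, ← sub_eq_add_neg, sub_nonneg]
          exact_mod_cast hω
      _ ≤ ∫⁻ ω, ENNReal.ofReal (Real.exp t) * ENNReal.ofReal (Real.exp (-(τ n ω : ℝ))) ∂P :=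
          setLIntegral_le_lintegral _ _
      _ ≤ _ := by
          have hm' : Measurable fun ω => ENNReal.ofReal (Real.exp (-(τ n ω : ℝ))) :=
            hexp.comp (measurable_coe_nnreal_real.comp (hε.measurable_time n))
          rw [lintegral_const_mul _ hm']
          gcongr
          exact hε.lintegral_exp_neg_time_le hγ hρ n
  refine ne_top_of_le_ne_top (ENNReal.mul_ne_top ENNReal.ofReal_ne_top
    (tsum_odd_mul_pow_ne_top hρ1) : ENNReal.ofReal (Real.exp t) * _ ≠ ⊤) ?_
  rw [← ENNReal.tsum_mul_left]
  refine ENNReal.tsum_le_tsum fun n => ?_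
  rw [mul_left_comm]
  gcongr
  exact htail n

end Tail

/-! ### Decomposition of the process into cycles -/

section Decomposition

/-- The gain of `X = T^c + N^h` up to time `t` over a cycle that starts at time `r` in the state
`i` and lasts for the time `v`. -/
def cycleGain (c h : D → ℝ → ℝ) (t : ℝ≥0) (i : D) (r : ℝ≥0) (v : ℝ) : ℝ :=
  if r ≤ t then (∫ u in (0 : ℝ)..min v (t - r), c i u) + if v ≤ t - r then h i v else 0 else 0

theorem cycleGain_of_lt (c h : D → ℝ → ℝ) {t : ℝ≥0} {i : D} {r : ℝ≥0} (hr : t < r) (v : ℝ) :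
    cycleGain c h t i r v = 0 := if_neg hr.not_ge

variable {ε : ℝ≥0 → Ω → D} {τ : ℕ → Ω → ℝ≥0} {z : D → ℝ → ℝ}

theorem IsSwitchingTimes.dagger_eq (hτ : IsSwitchingTimes ε τ) (z : D → ℝ → ℝ) {u : ℝ} {ω : Ω}
    {n : ℕ} (h1 : (τ n ω : ℝ) ≤ u) (h2 : u < τ (n + 1) ω) :
    dagger ε τ z u ω = z (ε (τ n ω) ω) (u - τ n ω) := by
  rw [dagger, (hτ.count_eq_iff ((τ n ω).2.trans h1) ω n).2 ⟨h1, h2⟩]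

/-- Clipping the switching times at `t` treats finished, running and future cycles alike; for a
future cycle both sides are zero. -/
theorem IsSwitchingTimes.dagger_cycle (hτ : IsSwitchingTimes ε τ)
    (hz : ∀ i, LocallyIntegrableOn (z i) (Ici 0)) (t : ℝ≥0) (n : ℕ) (ω : Ω) :
    IntervalIntegrable (fun u => dagger ε τ z u ω) volume (min (τ n ω) t : ℝ≥0)
        (min (τ (n + 1) ω) t : ℝ≥0) ∧
      ∫ u in (min (τ n ω) t : ℝ≥0)..(min (τ (n + 1) ω) t : ℝ≥0), dagger ε τ z u ω =
        cycleGain z 0 t (ε (τ n ω) ω) (τ n ω) (holdingTime τ n ω) := by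
  rcases lt_or_ge t (τ n ω) with h | h
  · rw [min_eq_right h.le, min_eq_right (h.le.trans (hτ.lt_succ n ω).le), cycleGain_of_lt _ _ h]
    exact ⟨IntervalIntegrable.refl, intervalIntegral.integral_same⟩
  · rw [min_eq_left h]
    have hle : τ n ω ≤ min (τ (n + 1) ω) t := le_min (hτ.lt_succ n ω).le h
    have hle' : (τ n ω : ℝ) ≤ (min (τ (n + 1) ω) t : ℝ≥0) := NNReal.coe_le_coe.2 hle
    have hae : ∀ᵐ u : ℝ, u ∈ uIoc (τ n ω : ℝ) (min (τ (n + 1) ω) t : ℝ≥0) →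
        z (ε (τ n ω) ω) (u - τ n ω) = dagger ε τ z u ω := by
      filter_upwards [(by simp [ae_iff, measure_singleton] :
        ∀ᵐ u : ℝ, u ≠ (min (τ (n + 1) ω) t : ℝ≥0))] with u hu hu'
      rw [uIoc_of_le hle'] at hu'
      refine (hτ.dagger_eq z hu'.1.le ((lt_of_le_of_ne hu'.2 hu).trans_le ?_)).symm
      exact NNReal.coe_le_coe.2 (min_le_left _ _)
    have hend : ((min (τ (n + 1) ω) t : ℝ≥0) : ℝ) - τ n ω = min (holdingTime τ n ω) (t - τ n ω) := by
      rw [NNReal.coe_min, holdingTime, min_sub_sub_right]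
    constructor
    · have hi := (intervalIntegrable_of_locallyIntegrableOn_Ici (hz (ε (τ n ω) ω)) le_rfl
        (sub_nonneg.2 hle')).comp_sub_right (τ n ω : ℝ)
      simp only [zero_add, sub_add_cancel] at hi
      exact hi.congr_ae ((ae_restrict_iff' measurableSet_uIoc).2 hae)
    · rw [← intervalIntegral.integral_congr_ae hae,
        intervalIntegral.integral_comp_sub_right (fun u => z (ε (τ n ω) ω) u), sub_self, hend,
        cycleGain, if_pos h]
      simp

theorem IsSwitchingTimes.intervalIntegrable_dagger (hτ : IsSwitchingTimes ε τ)
    (hz : ∀ i, LocallyIntegrableOn (z i) (Ici 0)) (t : ℝ≥0) (ω : Ω) :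
    IntervalIntegrable (fun u => dagger ε τ z u ω) volume 0 t := by
  obtain ⟨n, -, hn⟩ := hτ.exists_mem t ω
  have h := IntervalIntegrable.trans_iterate (f := fun u => dagger ε τ z u ω) (μ := volume)
    (a := fun k => ((min (τ k ω) t : ℝ≥0) : ℝ)) (n := n + 1)
    fun k _ => (hτ.dagger_cycle hz t k ω).1
  simpa [hτ.zero, min_eq_right hn.le] using h

theorem IsSwitchingTimes.telegraph_eq_sum (hτ : IsSwitchingTimes ε τ)
    (hz : ∀ i, LocallyIntegrableOn (z i) (Ici 0)) {t : ℝ≥0} {ω : Ω} {m : ℕ} (hm : t < τ m ω) :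
    telegraph ε τ z t ω = ∑ n ∈ Finset.range m,
      cycleGain z 0 t (ε (τ n ω) ω) (τ n ω) (holdingTime τ n ω) := by
  have h := intervalIntegral.sum_integral_adjacent_intervals (f := fun u => dagger ε τ z u ω)
    (μ := volume) (a := fun k => ((min (τ k ω) t : ℝ≥0) : ℝ)) (n := m)
    fun k _ => (hτ.dagger_cycle hz t k ω).1
  rw [telegraph, ← Finset.sum_congr rfl fun n _ => (hτ.dagger_cycle hz t n ω).2, h]
  simp [hτ.zero, min_eq_right hm.le]

theorem IsSwitchingTimes.jump_eq_sum (hτ : IsSwitchingTimes ε τ) (h : D → ℝ → ℝ) {t : ℝ≥0} {ω : Ω}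
    {m : ℕ} (hm : t < τ m ω) :
    jump ε τ h t ω = ∑ n ∈ Finset.range m,
      if τ (n + 1) ω ≤ t then h (ε (τ n ω) ω) (holdingTime τ n ω) else 0 := by
  have hlt : count τ t ω < m := (hτ.count_lt_iff t.2 ω m).2 (NNReal.coe_lt_coe.2 hm)
  rw [jump, ← Finset.sum_filter]
  refine Finset.sum_congr ?_ fun n _ => rfl
  ext n
  simp only [Finset.mem_range, Finset.mem_filter]
  have h1 := hτ.le_count_iff t.2 ω (n + 1)
  rw [Nat.succ_le_iff, NNReal.val_eq_coe, NNReal.coe_le_coe] at h1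
  rw [h1]
  exact ⟨fun h => ⟨(h1.2 h).trans hlt, h⟩, fun h => h.2⟩

theorem cycleGain_eq_add (c h : D → ℝ → ℝ) (t : ℝ≥0) (n : ℕ) (ω : Ω)
    (hτ : IsSwitchingTimes ε τ) :
    cycleGain c h t (ε (τ n ω) ω) (τ n ω) (holdingTime τ n ω) =
      cycleGain c 0 t (ε (τ n ω) ω) (τ n ω) (holdingTime τ n ω) +
        if τ (n + 1) ω ≤ t then h (ε (τ n ω) ω) (holdingTime τ n ω) else 0 := by
  have h1 : holdingTime τ n ω ≤ t - τ n ω ↔ τ (n + 1) ω ≤ t := by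
    rw [holdingTime, sub_le_sub_iff_right, NNReal.coe_le_coe]
  unfold cycleGain
  by_cases h2 : τ n ω ≤ t
  · simp [h1, h2]
  · rw [if_neg h2, if_neg h2, if_neg fun h3 => h2 ((hτ.lt_succ n ω).le.trans h3), add_zero]

theorem IsSwitchingTimes.switchingProcess_eq_sum (hτ : IsSwitchingTimes ε τ) {c : D → ℝ → ℝ}
    (hc : ∀ i, LocallyIntegrableOn (c i) (Ici 0)) (h : D → ℝ → ℝ) {t : ℝ≥0} {ω : Ω} {m : ℕ}
    (hm : t < τ m ω) :
    switchingProcess ε τ c h t ω = ∑ n ∈ Finset.range m,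
      cycleGain c h t (ε (τ n ω) ω) (τ n ω) (holdingTime τ n ω) := by
  rw [switchingProcess, hτ.telegraph_eq_sum hc hm, hτ.jump_eq_sum h hm, ← Finset.sum_add_distrib]
  exact Finset.sum_congr rfl fun n _ => (cycleGain_eq_add c h t n ω hτ).symm

theorem IsSwitchingTimes.hasSum_cycleGain (hτ : IsSwitchingTimes ε τ) {c : D → ℝ → ℝ}
    (hc : ∀ i, LocallyIntegrableOn (c i) (Ici 0)) (h : D → ℝ → ℝ) (t : ℝ≥0) (ω : Ω) :
    HasSum (fun n => cycleGain c h t (ε (τ n ω) ω) (τ n ω) (holdingTime τ n ω))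
      (switchingProcess ε τ c h t ω) := by
  obtain ⟨m, -, hm⟩ := hτ.exists_mem t ω
  rw [hτ.switchingProcess_eq_sum hc h hm]
  refine hasSum_sum_of_ne_finset_zero fun n hn => cycleGain_of_lt _ _ (hm.trans_le ?_) _
  exact (hτ.strictMono ω).monotone (by simpa using hn)

theorem abs_cycleGain_le [Fintype D] {c h : D → ℝ → ℝ}
    (hc : ∀ i, LocallyIntegrableOn (c i) (Ici 0)) (t : ℝ≥0) (i : D) (r : ℝ≥0) {v : ℝ}
    (hv : 0 ≤ v) : |cycleGain c h t i r v| ≤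
      if r ≤ t then (∑ j, ∫ u in (0 : ℝ)..t, |c j u|) + (if v ≤ t then |h i v| else 0) else 0 := by
  by_cases h1 : r ≤ t
  · rw [cycleGain, if_pos h1, if_pos h1]
    refine (abs_add_le _ _).trans (add_le_add ?_ ?_)
    · have ha : 0 ≤ min v (t - r) := le_min hv (sub_nonneg.2 (NNReal.coe_le_coe.2 h1))
      have hat : min v (t - r) ≤ t := (min_le_right _ _).trans (sub_le_self _ r.2)
      have hi := intervalIntegrable_of_locallyIntegrableOn_Ici (hc i).norm le_rfl t.2
      refine (intervalIntegral.abs_integral_le_integral_abs ha).trans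
        ((intervalIntegral.integral_mono_interval le_rfl ha hat
          (ae_of_all _ fun u => abs_nonneg _) hi).trans ?_)
      exact Finset.single_le_sum (f := fun j => ∫ u in (0 : ℝ)..t, |c j u|)
        (fun j _ => intervalIntegral.integral_nonneg t.2 fun u _ => abs_nonneg _)
        (Finset.mem_univ i)
    · by_cases h2 : v ≤ t - r
      · rw [if_pos h2, if_pos (h2.trans (sub_le_self _ r.2))]
      · rw [if_neg h2, abs_zero]
        split_ifs <;> simp
  · rw [cycleGain, if_neg h1, if_neg h1, abs_zero]

theorem IsSwitchingTimes.telegraph_abs_le [Fintype D] (hτ : IsSwitchingTimes ε τ)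
    (hz : ∀ i, LocallyIntegrableOn (z i) (Ici 0)) (t : ℝ≥0) (ω : Ω) :
    ∫ u in (0 : ℝ)..t, |dagger ε τ z u ω| ≤
      (count τ t ω + 1) * ∑ j, ∫ u in (0 : ℝ)..t, |z j u| := by
  have hz' : ∀ i, LocallyIntegrableOn (fun u => |z i u|) (Ici 0) := fun i => (hz i).norm
  have hlt : t < τ (count τ t ω + 1) ω := by
    exact_mod_cast ((hτ.count_eq_iff t.2 ω _).1 rfl).2
  have h := hτ.telegraph_eq_sum hz' hlt
  -- The absolute value commutes with `dagger`, so the cycle decomposition applies to the drift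
  -- `|z|`.
  change ∫ u in (0 : ℝ)..t, |dagger ε τ z u ω| = _ at h
  rw [h]
  refine (Finset.sum_le_card_nsmul _ _ (∑ j, ∫ u in (0 : ℝ)..t, |z j u|) fun n hn => ?_).trans
    (by simp)
  refine (le_abs_self _).trans ((abs_cycleGain_le hz' t _ _ (hτ.holdingTime_pos n ω).le).trans ?_)
  have h0 : 0 ≤ ∑ j, ∫ u in (0 : ℝ)..t, |z j u| := Finset.sum_nonneg fun j _ =>
    intervalIntegral.integral_nonneg t.2 fun u _ => abs_nonneg _
  split_ifs <;> simp [h0]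

theorem measurable_cycleGain {c h : D → ℝ → ℝ} (hc : ∀ i, Measurable (c i))
    (hh : ∀ i, Measurable (h i)) (t : ℝ≥0) (i : D) :
    Measurable (Function.uncurry (cycleGain c h t i)) := by
  have h1 : Measurable fun p : ℝ≥0 × ℝ => (t : ℝ) - p.1 :=
    measurable_const.sub (measurable_coe_nnreal_real.comp measurable_fst)
  unfold Function.uncurry cycleGain
  refine Measurable.ite (measurableSet_le measurable_fst measurable_const)
    (((measurable_primitive (hc i)).comp (measurable_snd.min h1)).add
      (Measurable.ite (measurableSet_le measurable_snd h1)
        ((hh i).comp measurable_snd) measurable_const)) measurable_const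

/-- The sums are eventually constant, with one nonzero term at most. This replaces the random index
`N(u)` by fixed indices and thereby gives measurability. -/
theorem IsSwitchingTimes.tendsto_sum_dagger (hτ : IsSwitchingTimes ε τ) (z : D → ℝ → ℝ) {u : ℝ}
    (hu : 0 ≤ u) (ω : Ω) :
    Tendsto (fun m => ∑ n ∈ Finset.range m, if (τ n ω : ℝ) ≤ u ∧ u < τ (n + 1) ω then
      z (ε (τ n ω) ω) (u - τ n ω) else 0) atTop (𝓝 (dagger ε τ z u ω)) := by
  refine tendsto_const_nhds.congr' ?_
  filter_upwards [eventually_gt_atTop (count τ u ω)] with m hm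
  rw [Finset.sum_eq_single_of_mem (count τ u ω) (Finset.mem_range.2 hm)]
  · rw [if_pos ((hτ.count_eq_iff hu ω _).1 rfl)]; rfl
  · exact fun n _ hn => if_neg fun h => hn ((hτ.count_eq_iff hu ω n).2 h).symm

variable [MeasurableSpace D] [MeasurableSingletonClass D] [Fintype D]

/-- The process `X = T^c + N^h` is adapted to the natural filtration of `ε`. -/
theorem IsSwitchingTimes.measurable_switchingProcess (hτ : IsSwitchingTimes ε τ) {c h : D → ℝ → ℝ}
    (hc : ∀ i, Measurable (c i)) (hh : ∀ i, Measurable (h i))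
    (hc' : ∀ i, LocallyIntegrableOn (c i) (Ici 0)) (t : ℝ≥0) :
    Measurable[past ε t] (switchingProcess ε τ c h t) := by
  refine @measurable_of_tendsto_metrizable _ _ (past ε t) _ _ _ _ (fun m ω =>
    ∑ n ∈ Finset.range m, cycleGain c h t (ε (τ n ω) ω) (τ n ω) (holdingTime τ n ω)) _
    (fun m => ?_) (tendsto_pi_nhds.2 fun ω => (hτ.hasSum_cycleGain hc' h t ω).tendsto_sum_nat)
  refine Finset.measurable_fun_sum (m := past ε t) _ fun n _ => ?_
  have hm := hτ.measurable_real_min n t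
  have hm1 := hτ.measurable_real_min (n + 1) t
  -- On `{τ_n ≤ t}` the gain depends on the switching times only through their values clipped at
  -- `t`, which the past of `ε` knows.
  have key := hτ.measurable_ite n t (f := fun i ω =>
    (∫ u in (0 : ℝ)..(min (τ (n + 1) ω : ℝ) t - min (τ n ω : ℝ) t), c i u) +
      {ω | τ (n + 1) ω ≤ t}.indicator
        (fun ω => h i (min (τ (n + 1) ω : ℝ) t - min (τ n ω : ℝ) t)) ω)
    fun i => ((measurable_primitive (hc i)).comp (hm1.sub hm)).add
      (((hh i).comp (hm1.sub hm)).indicator (hτ.measurableSet_le (n + 1) t))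
  convert key using 2 with ω
  rw [cycleGain_eq_add c h t n ω hτ, cycleGain]
  by_cases h1 : τ n ω ≤ t
  · have h1' : (τ n ω : ℝ) ≤ t := h1
    have h2 : min (holdingTime τ n ω) (t - τ n ω) = min (τ (n + 1) ω : ℝ) t - τ n ω := by
      rw [holdingTime, min_sub_sub_right]
    rw [if_pos h1, if_pos h1, min_eq_left h1', h2]
    by_cases h3 : τ (n + 1) ω ≤ t
    · have h3' : (τ (n + 1) ω : ℝ) ≤ t := h3
      simp [h3, h1', h3', holdingTime]
    · simp [h3]
  · rw [if_neg h1, if_neg h1, if_neg fun h3 => h1 ((hτ.lt_succ n ω).le.trans h3), add_zero]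

theorem IsSwitchingTimes.measurable_dagger (hτ : IsSwitchingTimes ε τ) (hz : ∀ i, Measurable (z i))
    (u : ℝ≥0) : Measurable[past ε u] (dagger ε τ z u) := by
  refine @measurable_of_tendsto_metrizable _ _ (past ε u) _ _ _ _ _ _ (fun m => ?_)
    (tendsto_pi_nhds.2 fun ω => hτ.tendsto_sum_dagger z u.2 ω)
  refine Finset.measurable_fun_sum (m := past ε u) _ fun n _ => ?_
  have key := hτ.measurable_ite n u (f := fun i => {ω | τ (n + 1) ω ≤ u}ᶜ.indicator
    (fun ω => z i (u - min (τ n ω : ℝ) u)))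
    fun i => ((hz i).comp (measurable_const.sub (hτ.measurable_real_min n u))).indicator
      (hτ.measurableSet_le (n + 1) u).compl
  convert key using 2 with ω
  by_cases h1 : τ n ω ≤ u
  · have h1' : (τ n ω : ℝ) ≤ u := h1
    by_cases h2 : u < τ (n + 1) ω
    · have h2' : (u : ℝ) < τ (n + 1) ω := h2
      simp [h1, h2, h1', h2']
    · have h2' : ¬ (u : ℝ) < τ (n + 1) ω := h2
      simp [h1, h1', h2, h2']
  · have h1' : ¬ (τ n ω : ℝ) ≤ u := h1
    simp [h1, h1']

theorem IsSwitchingTimes.measurable_dagger_prod [mΩ : MeasurableSpace Ω]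
    (hτ : IsSwitchingTimes ε τ) (hτm : ∀ n, Measurable (τ n))
    (hεm : ∀ n, Measurable fun ω => ε (τ n ω) ω) (hz : ∀ i, Measurable (z i)) :
    Measurable fun p : ℝ × Ω => if 0 ≤ p.1 then dagger ε τ z p.1 p.2 else 0 := by
  refine measurable_of_tendsto_metrizable (f := fun (m : ℕ) (p : ℝ × Ω) =>
    ∑ n ∈ Finset.range m, if (τ n p.2 : ℝ) ≤ p.1 ∧ p.1 < τ (n + 1) p.2 then
      z (ε (τ n p.2) p.2) (p.1 - τ n p.2) else 0) (fun m => ?_) (tendsto_pi_nhds.2 fun p => ?_)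
  · refine Finset.measurable_fun_sum _ fun n _ => ?_
    have hτr : ∀ k, Measurable fun p : ℝ × Ω => (τ k p.2 : ℝ) := fun k =>
      measurable_coe_nnreal_real.comp ((hτm k).comp measurable_snd)
    refine Measurable.ite ((_root_.measurableSet_le (hτr n) measurable_fst).inter
      (measurableSet_lt measurable_fst (hτr (n + 1)))) ?_ measurable_const
    exact measurable_of_fiber (X := fun p : ℝ × Ω => ε (τ n p.2) p.2)
      (fun i => ((hεm n).comp measurable_snd) (measurableSet_singleton i))
      (f := fun i p => z i (p.1 - τ n p.2)) fun i => (hz i).comp (measurable_fst.sub (hτr n))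
  · split_ifs with h
    · exact hτ.tendsto_sum_dagger z h p.2
    · refine tendsto_const_nhds.congr fun m => (Finset.sum_eq_zero fun n _ => if_neg ?_).symm
      exact fun h' => h ((τ n p.2).2.trans h'.1)

end Decomposition

/-! ### The balance equation and the mean gain of a cycle -/

section Compensated

variable [Fintype D] [DecidableEq D] [Nontrivial D] {γ : D → D → ℝ → ℝ} {c h : D → ℝ → ℝ}

theorem IsHazardRates.holdingLaw_Ici (hγ : IsHazardRates γ) (i : D) {t : ℝ} (ht : 0 ≤ t) :
    holdingLaw γ i (Ici t) = ENNReal.ofReal (survival γ i t) := by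
  rw [← hγ.holdingLaw_Ioi i ht]
  have hac : holdingLaw γ i ≪ volume :=
    (withDensity_absolutelyContinuous _ _).trans Measure.absolutelyContinuous_restrict
  exact (measure_congr (Ioi_ae_eq_Ici' (hac Real.volume_singleton))).symm

omit [Nontrivial D] in
/-- The expected total variation of the jump of a cycle is at most that of its drift. -/
theorem IsHazardRates.lintegral_jump_le (hγ : IsHazardRates γ) (hh : ∀ i, Measurable (h i))
    (h0 : ∀ i, ∀ᵐ t ∂(volume.restrict (Ici (0 : ℝ))), totalHazard γ i t * h i t + c i t = 0)
    (i : D) (a : ℝ) :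
    ∫⁻ v, (if v ≤ a then ‖h i v‖ₑ else 0) ∂holdingLaw γ i ≤ ∫⁻ u in Ioc 0 a, ‖c i u‖ₑ := by
  rw [hγ.lintegral_holdingLaw i (Measurable.ite measurableSet_Iic (hh i).enorm measurable_const),
    ← Ioi_inter_Iic, inter_comm, ← Measure.restrict_restrict measurableSet_Iic,
    ← lintegral_indicator measurableSet_Iic]
  refine lintegral_mono_ae ?_
  filter_upwards [ae_restrict_of_ae_restrict_of_subset Ioi_subset_Ici_self (h0 i),
    ae_restrict_mem measurableSet_Ioi] with v hv hv0
  by_cases hva : v ≤ a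
  · have hcv : c i v = -(totalHazard γ i v * h i v) := by linarith
    have hγv := hγ.totalHazard_nonneg i hv0
    rw [if_pos hva, indicator_of_mem (by exact hva), hcv, enorm_neg, enorm_mul,
      Real.enorm_of_nonneg hγv]
    gcongr
    exact mul_le_of_le_one_right hγv (hγ.survival_le_one i (le_of_lt hv0))
  · rw [if_neg hva, mul_zero]; exact zero_le

/-- The drift survives to age `u` with probability `survival γ i u`, and the jump at age `u` has
density `totalHazard γ i u * survival γ i u`. The two means cancel pointwise under the integral by
the balance equation. -/
theorem IsHazardRates.integral_cycleGain (hγ : IsHazardRates γ) (hc : ∀ i, Measurable (c i))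
    (hc' : ∀ i, LocallyIntegrableOn (c i) (Ici 0)) (hh : ∀ i, Measurable (h i))
    (h0 : ∀ i, ∀ᵐ t ∂(volume.restrict (Ici (0 : ℝ))), totalHazard γ i t * h i t + c i t = 0)
    (t : ℝ≥0) (i : D) (r : ℝ≥0) : ∫ v, cycleGain c h t i r v ∂holdingLaw γ i = 0 := by
  have := hγ.isProbabilityMeasure_holdingLaw i
  rcases lt_or_ge t r with hr | hr
  · simp [cycleGain_of_lt c h hr]
  set a : ℝ := t - r with ha
  have ha0 : 0 ≤ a := sub_nonneg.2 (NNReal.coe_le_coe.2 hr)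
  have hci : IntegrableOn (c i) (Ioc 0 a) :=
    (intervalIntegrable_of_locallyIntegrableOn_Ici (hc' i) le_rfl ha0).1
  have hdrift_int : Integrable (fun v => ∫ u in (0 : ℝ)..min v a, c i u) (holdingLaw γ i) := by
    refine Integrable.of_bound (C := ∫ u in (0 : ℝ)..a, |c i u|) ((measurable_primitive (hc i)).comp
      (measurable_id.min measurable_const)).aestronglyMeasurable ?_
    filter_upwards [ae_holdingLaw_pos γ i] with v hv
    have hva : 0 ≤ min v a := le_min hv.le ha0
    exact (intervalIntegral.abs_integral_le_integral_abs hva).trans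
      (intervalIntegral.integral_mono_interval le_rfl hva (min_le_right _ _)
        (ae_of_all _ fun u => abs_nonneg _)
        (intervalIntegrable_of_locallyIntegrableOn_Ici (hc' i).norm le_rfl ha0))
  have hjm : Measurable fun v => if v ≤ a then h i v else 0 :=
    Measurable.ite measurableSet_Iic (hh i) measurable_const
  have hjump_int : Integrable (fun v => if v ≤ a then h i v else 0) (holdingLaw γ i) := by
    refine ⟨hjm.aestronglyMeasurable, ?_⟩
    refine lt_of_le_of_lt (lintegral_mono fun v => ?_)
      ((hγ.lintegral_jump_le hh h0 i a).trans_lt hci.2)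
    by_cases hva : v ≤ a <;> simp [hva]
  have hjump : ∫ v, (if v ≤ a then h i v else 0) ∂holdingLaw γ i =
      -∫ u in Ioc 0 a, c i u * survival γ i u := by
    rw [hγ.integral_holdingLaw, ← integral_neg, ← Ioi_inter_Iic, inter_comm,
      ← Measure.restrict_restrict measurableSet_Iic, ← integral_indicator measurableSet_Iic]
    refine integral_congr_ae ?_
    filter_upwards [ae_restrict_of_ae_restrict_of_subset Ioi_subset_Ici_self (h0 i)] with v hv
    by_cases hva : v ≤ a
    · rw [if_pos hva, indicator_of_mem (by exact hva)]
      linear_combination survival γ i v * hv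
    · rw [if_neg hva, mul_zero, indicator_of_notMem (by exact hva)]
  have hdrift : ∫ v, (∫ u in (0 : ℝ)..min v a, c i u) ∂holdingLaw γ i =
      ∫ u in Ioc 0 a, c i u * survival γ i u := by
    have hF : Integrable (Function.uncurry fun v u : ℝ => if u ≤ v then c i u else 0)
        ((holdingLaw γ i).prod (volume.restrict (Ioc 0 a))) := by
      refine (hci.norm.comp_snd (holdingLaw γ i)).mono' (Measurable.ite
        (measurableSet_le measurable_snd measurable_fst) ((hc i).comp measurable_snd)
        measurable_const).aestronglyMeasurable (ae_of_all _ fun p => ?_)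
      simp only [Function.uncurry]
      split_ifs <;> simp
    calc ∫ v, (∫ u in (0 : ℝ)..min v a, c i u) ∂holdingLaw γ i
        = ∫ v, (∫ u in Ioc 0 a, if u ≤ v then c i u else 0) ∂holdingLaw γ i := by
          refine integral_congr_ae ?_
          filter_upwards [ae_holdingLaw_pos γ i] with v hv
          rw [intervalIntegral.integral_of_le (le_min hv.le ha0), min_comm, ← Ioc_inter_Iic,
            ← setIntegral_indicator measurableSet_Iic]
          rfl
      _ = ∫ u in Ioc 0 a, ∫ v, (if u ≤ v then c i u else 0) ∂holdingLaw γ i :=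
          integral_integral_swap hF
      _ = _ := by
          refine setIntegral_congr_fun measurableSet_Ioc fun u hu => ?_
          have : (fun v => if u ≤ v then c i u else 0) = (Ici u).indicator fun _ => c i u := by
            ext v; simp [indicator]
          rw [this, integral_indicator measurableSet_Ici, setIntegral_const, smul_eq_mul, mul_comm,
            Measure.real, hγ.holdingLaw_Ici i hu.1.le, ENNReal.toReal_ofReal (survival_pos γ i u).le]
  simp only [cycleGain, if_pos hr]
  rw [integral_add hdrift_int hjump_int, hdrift, hjump, add_neg_cancel]

end Compensated

/-! ### Sufficiency: the balance equation makes `X` a martingale -/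

section Martingale

variable [Fintype D] [DecidableEq D] [Nontrivial D] [MeasurableSpace D]
  [MeasurableSingletonClass D] {mΩ : MeasurableSpace Ω} {P : Measure Ω} [IsProbabilityMeasure P]
  {ℱ : Filtration ℝ≥0 mΩ} {γ : D → D → ℝ → ℝ} {ε : ℝ≥0 → Ω → D} {τ : ℕ → Ω → ℝ≥0}
  {c h : D → ℝ → ℝ}

omit [Nontrivial D] [MeasurableSingletonClass D] in
/-- Immersion for random variables instead of events. -/
theorem IsSemiMarkov.condExp_eq_past (hε : IsSemiMarkov P ℱ γ ε τ) (s : ℝ≥0) {Z : Ω → ℝ}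
    (hZ : Integrable Z P) (hZm : StronglyMeasurable[wholePath ε] Z) :
    P[Z | ℱ s] =ᵐ[P] P[Z | past ε s] := by
  have hps : past ε s ≤ mΩ := (hε.past_le s).trans (ℱ.le s)
  -- Approximation in `L¹`: indicators are the hypothesis, and the equality is a closed condition
  -- since conditional expectations are continuous on `L¹`.
  refine MemLp.induction_stronglyMeasurable (p := 1) hε.wholePath_le ENNReal.one_ne_top
    (fun f => P[f | ℱ s] =ᵐ[P] P[f | past ε s]) ?_ ?_ ?_ ?_ (memLp_one_iff_integrable.2 hZ)
    hZm.aestronglyMeasurable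
  · intro a A hA _
    have hind : (A.indicator fun _ => a) = a • A.indicator fun _ => (1 : ℝ) := by
      ext ω; by_cases hω : ω ∈ A <;> simp [hω]
    rw [hind]
    refine (condExp_smul a _ _).trans (EventuallyEq.trans ?_ (condExp_smul a _ _).symm)
    filter_upwards [hε.immersed s A hA] with ω hω
    simp only [Pi.smul_apply, hω]
  · intro f g _ hf hg _ _ hPf hPg
    have hf' := memLp_one_iff_integrable.1 hf
    have hg' := memLp_one_iff_integrable.1 hg
    exact (condExp_add hf' hg' _).trans ((hPf.add hPg).trans (condExp_add hf' hg' _).symm)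
  · have hset : {f : lpMeas ℝ ℝ (wholePath ε) 1 P |
        P[((f : Lp ℝ 1 P) : Ω → ℝ) | ℱ s] =ᵐ[P] P[((f : Lp ℝ 1 P) : Ω → ℝ) | past ε s]} =
        {f : lpMeas ℝ ℝ (wholePath ε) 1 P | condExpL1CLM ℝ (ℱ.le s) P (f : Lp ℝ 1 P) =
          condExpL1CLM ℝ hps P (f : Lp ℝ 1 P)} := by
      ext f
      have h1 := condExp_ae_eq_condExpL1CLM (ℱ.le s) (L1.integrable_coeFn (f : Lp ℝ 1 P))
      have h2 := condExp_ae_eq_condExpL1CLM hps (L1.integrable_coeFn (f : Lp ℝ 1 P))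
      rw [Integrable.toL1_coeFn] at h1 h2
      simp only [mem_ofPred_eq]
      rw [Lp.ext_iff]
      exact ⟨fun h => h1.symm.trans (h.trans h2), fun h => h1.trans (h.trans h2.symm)⟩
    rw [hset]
    exact isClosed_eq ((condExpL1CLM ℝ (ℱ.le s) P).continuous.comp continuous_subtype_val)
      ((condExpL1CLM ℝ hps P).continuous.comp continuous_subtype_val)
  · intro f g hfg _ hPf
    exact (condExp_congr_ae hfg.symm).trans (hPf.trans (condExp_congr_ae hfg))

omit [Nontrivial D] [IsProbabilityMeasure P] in
theorem IsSemiMarkov.measurable_apply_renewal (hε : IsSemiMarkov P ℱ γ ε τ) (n : ℕ)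
    {g : D → ℝ≥0 → ℝ → ℝ} (hg : ∀ i, Measurable (Function.uncurry (g i))) :
    Measurable fun ω => g (ε (τ n ω) ω) (τ n ω) (holdingTime τ n ω) :=
  measurable_of_fiber (hε.measurableSet_state n)
    (f := fun i ω => Function.uncurry (g i) (τ n ω, holdingTime τ n ω)) fun i =>
    (hg i).comp ((hε.measurable_time n).prodMk (hε.measurable_holdingTime n))

/-- The drift of a cycle started by `t` is at most `∑ j, ∫₀ᵗ |c j|`, and the balance equation bounds
the mean size of its jump by the same constant, whence the factor 2. -/
theorem IsSemiMarkov.lintegral_cycleGain_le (hγ : IsHazardRates γ) (hε : IsSemiMarkov P ℱ γ ε τ)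
    (hc' : ∀ i, LocallyIntegrableOn (c i) (Ici 0)) (hh : ∀ i, Measurable (h i))
    (h0 : ∀ i, ∀ᵐ t ∂(volume.restrict (Ici (0 : ℝ))), totalHazard γ i t * h i t + c i t = 0)
    (t : ℝ≥0) (n : ℕ) :
    ∫⁻ ω, ‖cycleGain c h t (ε (τ n ω) ω) (τ n ω) (holdingTime τ n ω)‖ₑ ∂P ≤
      2 * ENNReal.ofReal (∑ j, ∫ u in (0 : ℝ)..t, |c j u|) * P {ω | τ n ω ≤ t} := by
  set K : ℝ≥0∞ := ENNReal.ofReal (∑ j, ∫ u in (0 : ℝ)..t, |c j u|) with hK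
  have hm : MeasurableSet {ω | τ n ω ≤ t} := hε.measurable_time n measurableSet_Iic
  have hbd : ∀ i, ∫⁻ v, (if v ≤ t then ‖h i v‖ₑ else 0) ∂holdingLaw γ i ≤ K := by
    intro i
    refine (hγ.lintegral_jump_le hh h0 i t).trans ?_
    have hi : IntegrableOn (c i) (Ioc 0 (t : ℝ)) :=
      (intervalIntegrable_of_locallyIntegrableOn_Ici (hc' i) le_rfl t.2).1
    rw [← ofReal_integral_norm_eq_lintegral_enorm hi]
    refine ENNReal.ofReal_le_ofReal ?_
    rw [← intervalIntegral.integral_of_le t.coe_nonneg]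
    exact Finset.single_le_sum (f := fun j => ∫ u in (0 : ℝ)..t, |c j u|)
      (fun j _ => intervalIntegral.integral_nonneg t.2 fun u _ => abs_nonneg _)
      (Finset.mem_univ i)
  calc ∫⁻ ω, ‖cycleGain c h t (ε (τ n ω) ω) (τ n ω) (holdingTime τ n ω)‖ₑ ∂P
      ≤ ∫⁻ ω in {ω | τ n ω ≤ t}, K + (if holdingTime τ n ω ≤ t then
          ‖h (ε (τ n ω) ω) (holdingTime τ n ω)‖ₑ else 0) ∂P := by
        rw [← lintegral_indicator hm]
        refine lintegral_mono fun ω => ?_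
        have h1 := abs_cycleGain_le (h := h) hc' t (ε (τ n ω) ω) (τ n ω)
          (hε.switchingTimes.holdingTime_pos n ω).le
        rw [← Real.norm_eq_abs] at h1
        have h2 := ENNReal.ofReal_le_ofReal h1
        rw [ofReal_norm] at h2
        refine h2.trans ?_
        by_cases hω : τ n ω ≤ t
        · rw [if_pos hω, indicator_of_mem (by exact hω)]
          refine ENNReal.ofReal_add_le.trans (add_le_add le_rfl ?_)
          split_ifs
          · rw [← Real.norm_eq_abs, ofReal_norm]
          · simp
        · rw [if_neg hω]; simp
    _ = ∫⁻ ω in {ω | τ n ω ≤ t}, K + ∫⁻ v, (if v ≤ t then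
          ‖h (ε (τ n ω) ω) v‖ₑ else 0) ∂holdingLaw γ (ε (τ n ω) ω) ∂P := by
        rw [lintegral_add_left measurable_const, lintegral_add_left measurable_const]
        congr 1
        exact hε.setLIntegral_renewal hγ n (measurable_history_time ε τ le_rfl measurableSet_Iic)
          (g := fun i _ v => if v ≤ t then ‖h i v‖ₑ else 0) fun i =>
            (Measurable.ite measurableSet_Iic (hh i).enorm measurable_const).comp measurable_snd
    _ ≤ ∫⁻ ω in {ω | τ n ω ≤ t}, 2 * K ∂P := by
        refine lintegral_mono fun ω => ?_
        rw [two_mul]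
        exact add_le_add le_rfl (hbd _)
    _ = _ := by rw [setLIntegral_const]

theorem IsSemiMarkov.tsum_lintegral_cycleGain_ne_top (hγ : IsHazardRates γ)
    (hε : IsSemiMarkov P ℱ γ ε τ)
    (hc' : ∀ i, LocallyIntegrableOn (c i) (Ici 0)) (hh : ∀ i, Measurable (h i))
    (h0 : ∀ i, ∀ᵐ t ∂(volume.restrict (Ici (0 : ℝ))), totalHazard γ i t * h i t + c i t = 0)
    (t : ℝ≥0) :
    ∑' n, ∫⁻ ω, ‖cycleGain c h t (ε (τ n ω) ω) (τ n ω) (holdingTime τ n ω)‖ₑ ∂P ≠ ⊤ := by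
  refine ne_top_of_le_ne_top (ENNReal.mul_ne_top
    (ENNReal.mul_ne_top ENNReal.ofNat_ne_top ENNReal.ofReal_ne_top)
    (hε.tsum_measure_le_ne_top hγ t) :
    2 * ENNReal.ofReal (∑ j, ∫ u in (0 : ℝ)..t, |c j u|) * _ ≠ ⊤) ?_
  rw [← ENNReal.tsum_mul_left]
  refine ENNReal.tsum_le_tsum fun n => (hε.lintegral_cycleGain_le hγ hc' hh h0 t n).trans ?_
  gcongr
  exact le_mul_of_one_le_left (zero_le) le_add_self

theorem IsSemiMarkov.integrable_cycleGain (hγ : IsHazardRates γ) (hε : IsSemiMarkov P ℱ γ ε τ)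
    (hc : ∀ i, Measurable (c i))
    (hc' : ∀ i, LocallyIntegrableOn (c i) (Ici 0)) (hh : ∀ i, Measurable (h i))
    (h0 : ∀ i, ∀ᵐ t ∂(volume.restrict (Ici (0 : ℝ))), totalHazard γ i t * h i t + c i t = 0)
    (t : ℝ≥0) (n : ℕ) :
    Integrable (fun ω => cycleGain c h t (ε (τ n ω) ω) (τ n ω) (holdingTime τ n ω)) P :=
  ⟨(hε.measurable_apply_renewal n (measurable_cycleGain hc hh t)).aestronglyMeasurable,
    (ENNReal.ne_top_of_tsum_ne_top
      (hε.tsum_lintegral_cycleGain_ne_top hγ hc' hh h0 t) n).lt_top⟩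

theorem IsSemiMarkov.integrable_switchingProcess (hγ : IsHazardRates γ)
    (hε : IsSemiMarkov P ℱ γ ε τ) (hc : ∀ i, Measurable (c i))
    (hc' : ∀ i, LocallyIntegrableOn (c i) (Ici 0)) (hh : ∀ i, Measurable (h i))
    (h0 : ∀ i, ∀ᵐ t ∂(volume.restrict (Ici (0 : ℝ))), totalHazard γ i t * h i t + c i t = 0)
    (t : ℝ≥0) : Integrable (switchingProcess ε τ c h t) P := by
  refine ⟨((hε.switchingTimes.measurable_switchingProcess hc hh hc' t).mono
    ((past_le_wholePath ε t).trans hε.wholePath_le) le_rfl).aestronglyMeasurable, ?_⟩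
  refine lt_of_le_of_lt ?_ (hε.tsum_lintegral_cycleGain_ne_top hγ hc' hh h0 t).lt_top
  rw [← lintegral_tsum fun n =>
    (hε.measurable_apply_renewal n (measurable_cycleGain hc hh t)).enorm.aemeasurable]
  refine lintegral_mono fun ω => ?_
  rw [← (hε.switchingTimes.hasSum_cycleGain hc' h t ω).tsum_eq]
  exact enorm_tsum_le_tsum_enorm

/-- Over each single cycle the gain is a martingale. -/
theorem IsSemiMarkov.setIntegral_cycleGain_eq (hγ : IsHazardRates γ)
    (hε : IsSemiMarkov P ℱ γ ε τ) (hc : ∀ i, Measurable (c i))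
    (hc' : ∀ i, LocallyIntegrableOn (c i) (Ici 0)) (hh : ∀ i, Measurable (h i))
    (h0 : ∀ i, ∀ᵐ t ∂(volume.restrict (Ici (0 : ℝ))), totalHazard γ i t * h i t + c i t = 0)
    {s t : ℝ≥0} (hst : s ≤ t) (n : ℕ) {B : Set Ω} (hB : MeasurableSet[past ε s] B) :
    ∫ ω in B, cycleGain c h t (ε (τ n ω) ω) (τ n ω) (holdingTime τ n ω) ∂P =
      ∫ ω in B, cycleGain c h s (ε (τ n ω) ω) (τ n ω) (holdingTime τ n ω) ∂P := by
  obtain ⟨B', hB', hBB'⟩ := hε.switchingTimes.exists_history_set n s hB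
  have hBm : MeasurableSet B := hε.wholePath_le _ (past_le_wholePath ε s _ hB)
  have hBm' : MeasurableSet B' := hε.history_le n _ hB'
  have hi := fun u => hε.integrable_cycleGain hγ hc hc' hh h0 u n
  have hz : ∀ u, ∫ ω in B', cycleGain c h u (ε (τ n ω) ω) (τ n ω) (holdingTime τ n ω) ∂P = 0 :=
    fun u => hε.setIntegral_renewal_eq_zero hγ n hB' (measurable_cycleGain hc hh u) (hi u)
      (hγ.integral_cycleGain hc hc' hh h0 u)
  rw [← sub_eq_zero, ← integral_sub (hi t).integrableOn (hi s).integrableOn,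
    ← integral_indicator hBm]
  -- The right-hand zero is rewritten as the difference of the two vanishing integrals over `B'`,
  -- leaving a comparison of increments on `B` and `B'`.
  rw [← sub_zero (0 : ℝ)]
  nth_rw 1 [← hz t]
  rw [← hz s, ← integral_sub (hi t).integrableOn (hi s).integrableOn, ← integral_indicator hBm']
  refine integral_congr_ae (ae_of_all _ fun ω => ?_)
  rcases lt_or_ge s (τ (n + 1) ω) with hω | hω
  · by_cases hωB : ω ∈ B
    · rw [indicator_of_mem hωB, indicator_of_mem ((hBB' ω hω).1 hωB)]
    · rw [indicator_of_notMem hωB, indicator_of_notMem fun h => hωB ((hBB' ω hω).2 h)]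
  -- Once the cycle has ended by `s`, its gain is frozen and the increment is zero, whether or not
  -- `B` and `B'` agree.
  · have hconst : ∀ u : ℝ≥0, s ≤ u → cycleGain c h u (ε (τ n ω) ω) (τ n ω) (holdingTime τ n ω) =
        (∫ x in (0 : ℝ)..holdingTime τ n ω, c (ε (τ n ω) ω) x) +
          h (ε (τ n ω) ω) (holdingTime τ n ω) := by
      intro u hu
      have h1 : holdingTime τ n ω ≤ u - τ n ω :=
        sub_le_sub_right (NNReal.coe_le_coe.2 (hω.trans hu)) _
      rw [cycleGain, if_pos (((hε.switchingTimes.lt_succ n ω).le.trans hω).trans hu),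
        min_eq_left h1, if_pos h1]
    simp [indicator, hconst t hst, hconst s le_rfl]

theorem IsSemiMarkov.martingale_switchingProcess (hγ : IsHazardRates γ)
    (hε : IsSemiMarkov P ℱ γ ε τ) (hc : ∀ i, Measurable (c i))
    (hc' : ∀ i, LocallyIntegrableOn (c i) (Ici 0)) (hh : ∀ i, Measurable (h i))
    (h0 : ∀ i, ∀ᵐ t ∂(volume.restrict (Ici (0 : ℝ))), totalHazard γ i t * h i t + c i t = 0) :
    Martingale (switchingProcess ε τ c h) ℱ P := by
  have hm := hε.switchingTimes.measurable_switchingProcess hc hh hc'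
  have hint := hε.integrable_switchingProcess hγ hc hc' hh h0
  refine ⟨fun t => ((hm t).mono (hε.past_le t) le_rfl).stronglyMeasurable, fun s t hst => ?_⟩
  refine (hε.condExp_eq_past s (hint t)
    ((hm t).mono (past_le_wholePath ε t) le_rfl).stronglyMeasurable).trans ?_
  have hps : past ε s ≤ mΩ := (hε.past_le s).trans (ℱ.le s)
  refine (ae_eq_condExp_of_forall_setIntegral_eq hps (hint t)
    (fun B _ _ => (hint s).integrableOn) (fun B hB _ => ?_)
    (hm s).stronglyMeasurable.aestronglyMeasurable).symm
  have hsum : ∀ u, ∫ ω in B, switchingProcess ε τ c h u ω ∂P =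
      ∑' n, ∫ ω in B, cycleGain c h u (ε (τ n ω) ω) (τ n ω) (holdingTime τ n ω) ∂P := by
    intro u
    rw [← integral_tsum]
    · simp_rw [(hε.switchingTimes.hasSum_cycleGain hc' h u _).tsum_eq]
    · exact fun n => (hε.measurable_apply_renewal n
        (measurable_cycleGain hc hh u)).aestronglyMeasurable
    · exact ne_top_of_le_ne_top (hε.tsum_lintegral_cycleGain_ne_top hγ hc' hh h0 u)
        (ENNReal.tsum_le_tsum fun n => setLIntegral_le_lintegral _ _)
  rw [hsum, hsum]
  exact tsum_congr fun n => (hε.setIntegral_cycleGain_eq hγ hc hc' hh h0 hst n hB).symm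

end Martingale

/-! ### Necessity: integrability of the jumps and vanishing of telegraph martingales -/

section Converse

variable [Fintype D] [DecidableEq D] [Nontrivial D] [MeasurableSpace D]
  [MeasurableSingletonClass D] {mΩ : MeasurableSpace Ω} {P : Measure Ω} [IsProbabilityMeasure P]
  {ℱ : Filtration ℝ≥0 mΩ} {γ : D → D → ℝ → ℝ} {ε : ℝ≥0 → Ω → D} {τ : ℕ → Ω → ℝ≥0}
  {c h : D → ℝ → ℝ}

/-- Every state is visited with positive probability. -/
theorem IsSemiMarkov.exists_measure_state_ne_zero (hγ : IsHazardRates γ)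
    (hε : IsSemiMarkov P ℱ γ ε τ) (i : D) : ∃ n, P {ω | ε (τ n ω) ω = i} ≠ 0 := by
  by_contra! hi
  have h1 := setIntegral_eq_sum_fiber (hε.measurableSet_state 0) (integrable_const (1 : ℝ))
    univ MeasurableSet.univ (μ := P)
  simp only [setIntegral_const, smul_eq_mul, mul_one, univ_inter, probReal_univ] at h1
  -- Some state carries mass at time 0, and from it `i` is reached at the first switch with positive
  -- probability.
  obtain ⟨k, -, hk⟩ := Finset.exists_ne_zero_of_sum_ne_zero (h1 ▸ one_ne_zero)
  have hki : k ≠ i := by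
    rintro rfl
    exact hk (by rw [Measure.real, hi 0, ENNReal.toReal_zero])
  have h2 := hε.measureReal_transition 0 k i (B := univ) MeasurableSet.univ le_rfl
  rw [univ_inter] at h2
  have h3 : P.real ({ω | ε (τ 0 ω) ω = k} ∩
      {ω | 0 < holdingTime τ 0 ω ∧ ε (τ (0 + 1) ω) ω = i}) = 0 := by
    rw [Measure.real, measure_mono_null _ (hi 1), ENNReal.toReal_zero]
    exact fun ω hω => hω.2.2
  rw [h3] at h2
  exact (mul_ne_zero hk (hγ.transitionTail_zero_pos hki).ne') h2.symm

/-- The constant is the smallest survival probability to age `t` over the states. Being independent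
of `n` and of the history, it lets integrability on the event of a long cycle be transferred to the
whole space. -/
theorem IsSemiMarkov.exists_mul_lintegral_le (hγ : IsHazardRates γ)
    (hε : IsSemiMarkov P ℱ γ ε τ) (t : ℝ≥0) : ∃ δ : ℝ≥0∞, δ ≠ 0 ∧ ∀ (n : ℕ) (W : Ω → ℝ≥0∞),
      Measurable[history ε τ n] W →
      δ * ∫⁻ ω, W ω ∂P ≤ ∫⁻ ω in {ω | (t : ℝ) < holdingTime τ n ω}, W ω ∂P := by
  obtain ⟨i₀, hi₀⟩ := Finite.exists_min fun i : D => survival γ i t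
  refine ⟨ENNReal.ofReal (survival γ i₀ t), by simp [survival_pos], fun n W hW => ?_⟩
  have hTm : MeasurableSet {ω | (t : ℝ) < holdingTime τ n ω} :=
    measurableSet_lt measurable_const (hε.measurable_holdingTime n)
  rw [← setLIntegral_univ, setLIntegral_eq_sum_fiber (hε.measurableSet_state n) _ _ hTm,
    setLIntegral_eq_sum_fiber (hε.measurableSet_state n) _ _ MeasurableSet.univ, Finset.mul_sum]
  refine Finset.sum_le_sum fun i _ => ?_
  rw [univ_inter, inter_comm, hε.setLIntegral_survive hγ n i hW t.coe_nonneg]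
  gcongr
  exact hi₀ i

omit [DecidableEq D] [Nontrivial D] in
theorem measurable_history_jump (hh : ∀ i, Measurable (h i)) (t : ℝ≥0) (n : ℕ) :
    Measurable[history ε τ (n + 1)] ({ω | τ (n + 1) ω ≤ t}.indicator fun ω =>
      ‖h (ε (τ n ω) ω) (holdingTime τ n ω)‖ₑ) := by
  have h1 := measurable_history_time ε τ (le_refl (n + 1))
  have h2 := measurable_history_time ε τ n.le_succ
  refine Measurable.indicator (m := history ε τ (n + 1)) ?_ (h1 measurableSet_Iic)
  refine measurable_of_fiber (m := history ε τ (n + 1))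
    (fun i => measurable_history_state ε τ n.le_succ (measurableSet_singleton i))
    (f := fun i ω => ‖h i (holdingTime τ n ω)‖ₑ) fun i => ?_
  have hT : Measurable[history ε τ (n + 1)] (holdingTime τ n) :=
    (measurable_coe_nnreal_real.comp h1).sub (measurable_coe_nnreal_real.comp h2)
  exact (hh i).enorm.comp hT

/-- If `X(t)` is integrable for all `t`, so is each of its jumps. -/
theorem IsSemiMarkov.lintegral_jump_ne_top (hγ : IsHazardRates γ)
    (hε : IsSemiMarkov P ℱ γ ε τ) (hc' : ∀ i, LocallyIntegrableOn (c i) (Ici 0))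
    (hh : ∀ i, Measurable (h i)) (t : ℝ≥0) (hX : Integrable (switchingProcess ε τ c h t) P)
    (n : ℕ) :
    ∫⁻ ω, {ω | τ (n + 1) ω ≤ t}.indicator
      (fun ω => ‖h (ε (τ n ω) ω) (holdingTime τ n ω)‖ₑ) ω ∂P ≠ ⊤ := by
  have hτ := hε.switchingTimes
  obtain ⟨δ, hδ, hW⟩ := hε.exists_mul_lintegral_le hγ t
  induction n using Nat.strong_induction_on with
  | _ n ih =>
    set J : ℕ → Ω → ℝ≥0∞ := fun k => {ω | τ (k + 1) ω ≤ t}.indicator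
      (fun ω => ‖h (ε (τ k ω) ω) (holdingTime τ k ω)‖ₑ) with hJ
    have hJm : ∀ k, Measurable (J k) := fun k =>
      (measurable_history_jump hh t k).mono (hε.history_le (k + 1)) le_rfl
    set K : ℝ≥0∞ := ENNReal.ofReal ((n + 1 + 1) * ∑ j, ∫ u in (0 : ℝ)..t, |c j u|) with hK
    have hTm : MeasurableSet {ω | (t : ℝ) < holdingTime τ (n + 1) ω} :=
      measurableSet_lt measurable_const (hε.measurable_holdingTime (n + 1))
    -- If the cycle after the jump at `τ_{n+1} ≤ t` outlasts `t`, then `N(t) = n + 1`, and that jump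
    -- is `X(t)` minus drift and earlier jumps. The factor `n + 1 + 1` in `K` is `N(t) + 1`.
    have hpt : ∀ ω, (t : ℝ) < holdingTime τ (n + 1) ω → J n ω ≤
        ‖(switchingProcess ε τ c h t) ω‖ₑ + (K + ∑ k ∈ Finset.range n, J k ω) := by
      intro ω hω
      by_cases hn : τ (n + 1) ω ≤ t
      · have hlt : (t : ℝ) < τ (n + 1 + 1) ω :=
          hω.trans_le (sub_le_self _ (τ (n + 1) ω).coe_nonneg)
        have hcount : count τ t ω = n + 1 :=
          (hτ.count_eq_iff t.coe_nonneg ω _).2 ⟨NNReal.coe_le_coe.2 hn, hlt⟩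
        have hJk : ∀ k ≤ n, J k ω = ‖h (ε (τ k ω) ω) (holdingTime τ k ω)‖ₑ := fun k hk =>
          indicator_of_mem (s := {ω | τ (k + 1) ω ≤ t})
            (((hτ.strictMono ω).monotone (Nat.succ_le_succ hk)).trans hn) _
        rw [hJk n le_rfl, Finset.sum_congr rfl fun k hk => hJk k (Finset.mem_range.1 hk).le]
        have hjump : jump ε τ h t ω = ∑ k ∈ Finset.range n,
            h (ε (τ k ω) ω) (holdingTime τ k ω) + h (ε (τ n ω) ω) (holdingTime τ n ω) := by
          rw [jump, hcount, Finset.sum_range_succ]; rfl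
        have hz : h (ε (τ n ω) ω) (holdingTime τ n ω) = switchingProcess ε τ c h t ω -
            (telegraph ε τ c t ω + ∑ k ∈ Finset.range n,
              h (ε (τ k ω) ω) (holdingTime τ k ω)) := by
          rw [switchingProcess, hjump]; ring
        rw [hz]
        refine (enorm_sub_le).trans (add_le_add le_rfl ((enorm_add_le _ _).trans
          (add_le_add ?_ (enorm_sum_le _ _))))
        rw [← ofReal_norm]
        refine ENNReal.ofReal_le_ofReal ?_
        refine (intervalIntegral.abs_integral_le_integral_abs t.coe_nonneg).trans ?_
        refine (hτ.telegraph_abs_le hc' t ω).trans (le_of_eq ?_)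
        rw [hcount]; push_cast; ring
      · rw [hJ]
        simp only
        rw [indicator_of_notMem (by exact hn)]
        exact zero_le
    have hfin : ∫⁻ ω, ‖(switchingProcess ε τ c h t) ω‖ₑ +
        (K + ∑ k ∈ Finset.range n, J k ω) ∂P ≠ ⊤ := by
      have hm : Measurable fun ω => K + ∑ k ∈ Finset.range n, J k ω :=
        measurable_const.add (Finset.measurable_fun_sum _ fun k _ => hJm k)
      rw [lintegral_add_right _ hm, lintegral_add_left measurable_const,
        lintegral_finsetSum _ fun k _ => hJm k, lintegral_const]
      refine ENNReal.add_ne_top.2 ⟨hX.2.ne, ENNReal.add_ne_top.2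
        ⟨ENNReal.mul_ne_top ENNReal.ofReal_ne_top (measure_ne_top _ _), ?_⟩⟩
      exact ENNReal.sum_ne_top.2 fun k hk => ih k (Finset.mem_range.1 hk)
    have hle : δ * ∫⁻ ω, J n ω ∂P ≤
        ∫⁻ ω, ‖(switchingProcess ε τ c h t) ω‖ₑ + (K + ∑ k ∈ Finset.range n, J k ω) ∂P :=
      (hW (n + 1) (J n) (measurable_history_jump hh t n)).trans
        ((setLIntegral_mono' hTm hpt).trans (setLIntegral_le_lintegral _ _))
    intro htop
    change ∫⁻ ω, J n ω ∂P = ⊤ at htop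
    rw [htop, ENNReal.mul_top hδ] at hle
    exact hfin (top_le_iff.1 hle)

/-- Conditioning an integrable jump on its starting state shows that `h_i` is integrable on `[0, t]`
under the holding law, whose density dominates `totalHazard γ i * survival γ i t` there. -/
theorem IsSemiMarkov.locallyIntegrableOn_hazard_mul (hγ : IsHazardRates γ)
    (hε : IsSemiMarkov P ℱ γ ε τ) (hc' : ∀ i, LocallyIntegrableOn (c i) (Ici 0))
    (hh : ∀ i, Measurable (h i)) (hX : ∀ t, Integrable (switchingProcess ε τ c h t) P) (i : D) :
    LocallyIntegrableOn (fun u => totalHazard γ i u * h i u) (Ici 0) := by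
  refine locallyIntegrableOn_Ici_of_intervalIntegrable fun t ht => ?_
  lift t to ℝ≥0 using ht
  obtain ⟨n, hn⟩ := hε.exists_measure_state_ne_zero hγ i
  -- Jump integrability is available at deterministic times only; if `τ_n ≤ K`, a cycle of length at
  -- most `t` ends by `K + t`.
  obtain ⟨K, hK⟩ : ∃ K : ℕ, P ({ω | τ n ω ≤ K} ∩ {ω | ε (τ n ω) ω = i}) ≠ 0 := by
    by_contra! hK
    refine hn (measure_mono_null (fun ω hω => ?_) (measure_iUnion_null hK))
    obtain ⟨K, hK'⟩ := exists_nat_ge (τ n ω)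
    exact mem_iUnion.2 ⟨K, hK', hω⟩
  set B : Set Ω := {ω | τ n ω ≤ K} with hB
  have hBh : MeasurableSet[history ε τ n] B := measurable_history_time ε τ le_rfl measurableSet_Iic
  have hBm := hε.history_le n _ hBh
  have hfm : Measurable fun v => (Iic (t : ℝ)).indicator (fun v => ‖h i v‖ₑ) v :=
    (hh i).enorm.indicator measurableSet_Iic
  have h1 : P (B ∩ {ω | ε (τ n ω) ω = i}) *
      ∫⁻ v, (Iic (t : ℝ)).indicator (fun v => ‖h i v‖ₑ) v ∂holdingLaw γ i =
      ∫⁻ ω in B ∩ {ω | ε (τ n ω) ω = i},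
        (Iic (t : ℝ)).indicator (fun v => ‖h i v‖ₑ) (holdingTime τ n ω) ∂P := by
    rw [← lintegral_map hfm (hε.measurable_holdingTime n), hε.map_holdingTime hγ n i hBh,
      lintegral_smul_measure, smul_eq_mul]
  have h2 : ∫⁻ ω in B ∩ {ω | ε (τ n ω) ω = i},
      (Iic (t : ℝ)).indicator (fun v => ‖h i v‖ₑ) (holdingTime τ n ω) ∂P ≤
      ∫⁻ ω, {ω | τ (n + 1) ω ≤ (K : ℝ≥0) + t}.indicator
        (fun ω => ‖h (ε (τ n ω) ω) (holdingTime τ n ω)‖ₑ) ω ∂P := by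
    refine (setLIntegral_mono' (hBm.inter (hε.measurableSet_state n i)) fun ω hω => ?_).trans
      (setLIntegral_le_lintegral _ _)
    by_cases hv : holdingTime τ n ω ≤ t
    · have hmem : ω ∈ {ω | τ (n + 1) ω ≤ (K : ℝ≥0) + t} := by
        have h3 : (τ n ω : ℝ) ≤ (K : ℝ≥0) := NNReal.coe_le_coe.2 hω.1
        have h4 : (τ (n + 1) ω : ℝ) - τ n ω ≤ t := hv
        refine NNReal.coe_le_coe.1 ?_
        rw [NNReal.coe_add]
        linarith
      rw [indicator_of_mem (by exact hv), indicator_of_mem hmem,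
        show ε (τ n ω) ω = i from hω.2]
    · rw [indicator_of_notMem (by exact hv)]
      exact zero_le
  have h3 : ∫⁻ v, (Iic (t : ℝ)).indicator (fun v => ‖h i v‖ₑ) v ∂holdingLaw γ i ≠ ⊤ := by
    intro htop
    rw [htop, ENNReal.mul_top hK] at h1
    exact hε.lintegral_jump_ne_top hγ hc' hh _ (hX _) n (top_le_iff.1 (h1 ▸ h2))
  have h4 : ENNReal.ofReal (survival γ i t) * ∫⁻ v in Ioc 0 (t : ℝ), ‖totalHazard γ i v * h i v‖ₑ ≤
      ∫⁻ v, (Iic (t : ℝ)).indicator (fun v => ‖h i v‖ₑ) v ∂holdingLaw γ i := by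
    have hm : Measurable fun v => ‖totalHazard γ i v * h i v‖ₑ :=
      ((hγ.measurable_totalHazard i).mul (hh i)).enorm
    rw [hγ.lintegral_holdingLaw i hfm, ← lintegral_const_mul _ hm]
    refine (setLIntegral_mono' measurableSet_Ioc fun v hv => ?_).trans
      (lintegral_mono_set Ioc_subset_Ioi_self)
    rw [indicator_of_mem (by exact hv.2), enorm_mul,
      Real.enorm_of_nonneg (hγ.totalHazard_nonneg i hv.1),
      ENNReal.ofReal_mul (hγ.totalHazard_nonneg i hv.1), ← mul_assoc,
      mul_comm (ENNReal.ofReal (survival γ i t))]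
    gcongr
    exact hγ.survival_anti i hv.1.le hv.2
  rw [intervalIntegrable_iff_integrableOn_Ioc_of_le t.coe_nonneg]
  refine ⟨((hγ.measurable_totalHazard i).mul (hh i)).aestronglyMeasurable, ?_⟩
  refine lt_top_iff_ne_top.2 fun htop => h3 ?_
  rw [htop, ENNReal.mul_top (by simp [survival_pos])] at h4
  exact top_le_iff.1 h4

/-- The number of switches up to `t` is square integrable. -/
theorem IsSemiMarkov.lintegral_count_sq_ne_top (hγ : IsHazardRates γ)
    (hε : IsSemiMarkov P ℱ γ ε τ) (t : ℝ≥0) :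
    ∫⁻ ω, ((count τ t ω + 1 : ℕ) : ℝ≥0∞) ^ 2 ∂P ≠ ⊤ := by
  have hm : ∀ n, MeasurableSet {ω | τ n ω ≤ t} := fun n => hε.measurable_time n measurableSet_Iic
  have hsq : ∀ m : ℕ, (m : ℝ≥0∞) ^ 2 = ∑ n ∈ Finset.range m, (2 * (n : ℝ≥0∞) + 1) := by
    intro m
    induction m with
    | zero => simp
    | succ m ih => rw [Finset.sum_range_succ, ← ih]; push_cast; ring
  refine ne_top_of_le_ne_top (hε.tsum_measure_le_ne_top hγ t) ?_
  calc ∫⁻ ω, ((count τ t ω + 1 : ℕ) : ℝ≥0∞) ^ 2 ∂P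
      ≤ ∫⁻ ω, ∑' n : ℕ, {ω | τ n ω ≤ t}.indicator (fun _ => 2 * (n : ℝ≥0∞) + 1) ω ∂P := by
        refine lintegral_mono fun ω => ?_
        simp only
        rw [hsq]
        refine le_trans (Finset.sum_le_sum fun n hn => ?_) (ENNReal.sum_le_tsum _)
        have hmem : ω ∈ {ω | τ n ω ≤ t} := NNReal.coe_le_coe.1
          ((hε.switchingTimes.le_count_iff t.coe_nonneg ω n).1
            (Nat.lt_succ_iff.1 (Finset.mem_range.1 hn)))
        rw [indicator_of_mem hmem]
    _ = _ := by
        rw [lintegral_tsum fun n => (measurable_const.indicator (hm n)).aemeasurable]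
        refine tsum_congr fun n => ?_
        rw [lintegral_indicator_const (hm n)]

/-- A telegraph process that is a martingale vanishes: its square has zero expectation. -/
theorem IsSemiMarkov.telegraph_ae_eq_zero (hγ : IsHazardRates γ)
    (hε : IsSemiMarkov P ℱ γ ε τ) {z : D → ℝ → ℝ} (hz : ∀ i, Measurable (z i))
    (hz' : ∀ i, LocallyIntegrableOn (z i) (Ici 0)) (hM : Martingale (telegraph ε τ z) ℱ P)
    (t : ℝ≥0) : telegraph ε τ z t =ᵐ[P] 0 := by
  have hτ := hε.switchingTimes
  -- Truncation at negative times gives joint measurability in time and `ω`; on `[0, t]` nothing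
  -- changes.
  set d : ℝ × Ω → ℝ := fun p => if 0 ≤ p.1 then dagger ε τ z p.1 p.2 else 0 with hd
  have hdm : Measurable d := hτ.measurable_dagger_prod hε.measurable_time hε.measurable_state hz
  have hd0 : ∀ u : ℝ, 0 ≤ u → ∀ ω, d (u, ω) = dagger ε τ z u ω := fun u hu ω => if_pos hu
  set I : ℝ × Ω → ℝ := fun p => ∫ w in (0 : ℝ)..p.1, d (w, p.2) with hI
  have hIm : Measurable I := measurable_primitive_prod hdm
  have hId : ∀ (u : ℝ≥0) ω, I (u, ω) = telegraph ε τ z u ω := fun u ω => by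
    refine intervalIntegral.integral_congr_ae (ae_of_all _ fun w hw => ?_)
    rw [uIoc_of_le u.coe_nonneg] at hw
    exact hd0 w hw.1.le ω
  have hdi : ∀ ω, IntervalIntegrable (fun u => d (u, ω)) volume 0 t := fun ω => by
    refine (hτ.intervalIntegrable_dagger hz' t ω).congr_ae
      ((ae_restrict_iff' measurableSet_uIoc).2 (ae_of_all _ fun w hw => ?_))
    rw [uIoc_of_le t.coe_nonneg] at hw
    exact (hd0 w hw.1.le ω).symm
  set K : ℝ := ∑ j, ∫ u in (0 : ℝ)..t, |z j u| with hK
  have hK0 : 0 ≤ K := Finset.sum_nonneg fun j _ =>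
    intervalIntegral.integral_nonneg t.coe_nonneg fun u _ => abs_nonneg _
  have hV : ∀ ω, ∫ u in (0 : ℝ)..t, |d (u, ω)| ≤ (count τ t ω + 1) * K := fun ω => by
    refine le_of_eq_of_le ?_ (hτ.telegraph_abs_le hz' t ω)
    refine intervalIntegral.integral_congr_ae (ae_of_all _ fun w hw => ?_)
    rw [uIoc_of_le t.coe_nonneg] at hw
    simp only [hd0 w hw.1.le ω]
  have hincr : ∀ ω, ∀ u ∈ Ioc (0 : ℝ) t, |I (t, ω) - I (u, ω)| ≤ (count τ t ω + 1) * K := by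
    intro ω u hu
    have hu' : u ∈ uIcc (0 : ℝ) t := by rw [uIcc_of_le t.coe_nonneg]; exact ⟨hu.1.le, hu.2⟩
    have h1 : IntervalIntegrable (fun u => d (u, ω)) volume 0 u :=
      (hdi ω).mono_set (uIcc_subset_uIcc left_mem_uIcc hu')
    simp only [hI]
    rw [intervalIntegral.integral_interval_sub_left (hdi ω) h1]
    refine (intervalIntegral.abs_integral_le_integral_abs hu.2).trans (le_trans ?_ (hV ω))
    exact intervalIntegral.integral_mono_interval hu.1.le hu.2 le_rfl
      (ae_of_all _ fun u => abs_nonneg _) (hdi ω).norm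
  set G : Ω × ℝ → ℝ := fun p => d (p.2, p.1) * (I (t, p.1) - I (p.2, p.1)) with hG
  have hGm : Measurable G := (hdm.comp measurable_swap).mul
    ((hIm.comp (measurable_const.prodMk measurable_fst)).sub (hIm.comp measurable_swap))
  -- For fixed `ω` the integral of `|G|` is at most the total variation times the largest increment,
  -- hence at most `((N(t) + 1) K)²`. This is where the second moment of `N(t)` is needed.
  have hGint : Integrable G (P.prod (volume.restrict (Ioc (0 : ℝ) t))) := by
    refine ⟨hGm.aestronglyMeasurable, ?_⟩
    rw [HasFiniteIntegral, lintegral_prod _ hGm.enorm.aemeasurable]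
    refine lt_of_le_of_lt ?_ (ENNReal.mul_lt_top (ENNReal.pow_lt_top (n := 2)
      (ENNReal.ofReal_lt_top (r := K))) (hε.lintegral_count_sq_ne_top hγ t).lt_top)
    rw [← lintegral_const_mul' _ _ (ENNReal.pow_ne_top ENNReal.ofReal_ne_top)]
    refine lintegral_mono fun ω => ?_
    set M : ℝ := (count τ t ω + 1) * K with hMdef
    have hM0 : 0 ≤ M := mul_nonneg (by positivity) hK0
    calc ∫⁻ u in Ioc (0 : ℝ) t, ‖G (ω, u)‖ₑ
        ≤ ∫⁻ u in Ioc (0 : ℝ) t, ‖d (u, ω)‖ₑ * ENNReal.ofReal M := by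
          refine setLIntegral_mono' measurableSet_Ioc fun u hu => ?_
          rw [hG, enorm_mul]
          gcongr
          rw [← ofReal_norm]
          exact ENNReal.ofReal_le_ofReal (hincr ω u hu)
      _ ≤ ENNReal.ofReal M * ENNReal.ofReal M := by
          rw [lintegral_mul_const' _ _ ENNReal.ofReal_ne_top]
          gcongr
          rw [← ofReal_integral_norm_eq_lintegral_enorm (hdi ω).1,
            ← intervalIntegral.integral_of_le t.coe_nonneg]
          exact ENNReal.ofReal_le_ofReal (hV ω)
      _ = _ := by
          rw [← ENNReal.ofReal_mul hM0, hMdef, ← ENNReal.ofReal_pow hK0, ← ENNReal.ofReal_natCast,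
            ← ENNReal.ofReal_pow (by positivity), ← ENNReal.ofReal_mul (by positivity)]
          congr 1
          push_cast
          ring
  have hsec : ∀ᵐ u ∂(volume.restrict (Ioc (0 : ℝ) t)), ∫ ω, G (ω, u) ∂P = 0 := by
    filter_upwards [hGint.prod_left_ae, ae_restrict_mem measurableSet_Ioc] with u hu hu0
    lift u to ℝ≥0 using hu0.1.le
    have hut : u ≤ t := NNReal.coe_le_coe.1 hu0.2
    have hfun : (fun ω => G (ω, u)) =
        dagger ε τ z u * (telegraph ε τ z t - telegraph ε τ z u) := by
      ext ω
      simp only [hG, Pi.mul_apply, Pi.sub_apply, hId, hd0 u u.coe_nonneg ω]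
    rw [hfun] at hu ⊢
    have hs : StronglyMeasurable[ℱ u] (dagger ε τ z u) :=
      ((hτ.measurable_dagger hz u).mono (hε.past_le u) le_rfl).stronglyMeasurable
    -- The value of the integrand at `u` is known at time `u`, so it factors out, and the remaining
    -- martingale increment has conditional mean zero.
    have h1 := condExp_mul_of_stronglyMeasurable_left hs hu
      ((hM.integrable t).sub (hM.integrable u))
    have h2 : P[telegraph ε τ z t - telegraph ε τ z u | ℱ u] =ᵐ[P] 0 := by
      refine (condExp_sub (hM.integrable t) (hM.integrable u) _).trans ?_
      filter_upwards [hM.2 u t hut, hM.2 u u le_rfl] with ω e1 e2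
      simp [e1, e2]
    rw [← integral_condExp (ℱ.le u), integral_congr_ae h1]
    refine integral_eq_zero_of_ae ?_
    filter_upwards [h2] with ω e
    simp [e]
  have hsq : ∀ ω, I (t, ω) ^ 2 = 2 * ∫ u in Ioc (0 : ℝ) t, G (ω, u) := fun ω => by
    rw [← intervalIntegral.integral_of_le t.coe_nonneg]
    exact sq_integral_eq (hdi ω)
  have hE : ∫ ω, I (t, ω) ^ 2 ∂P = 0 := by
    simp_rw [hsq]
    rw [integral_const_mul, integral_integral_swap (f := fun ω u => G (ω, u)) hGint,
      integral_eq_zero_of_ae hsec, mul_zero]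
  have hIsq : Integrable (fun ω => I (t, ω) ^ 2) P := by
    simp_rw [hsq]
    exact hGint.integral_prod_left.const_mul 2
  filter_upwards [(integral_eq_zero_iff_of_nonneg (fun ω => sq_nonneg _) hIsq).1 hE] with ω hω
  rw [← hId]
  exact pow_eq_zero_iff two_ne_zero |>.1 hω

/-- During a cycle in the state `i` that outlasts `v`, the process increases by exactly `∫₀ᵛ z_i`.
Such a cycle has positive probability, so one path on which the process vanishes at all times
suffices. -/
theorem IsSemiMarkov.ae_eq_zero_of_telegraph (hγ : IsHazardRates γ)
    (hε : IsSemiMarkov P ℱ γ ε τ) {z : D → ℝ → ℝ}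
    (hz' : ∀ i, LocallyIntegrableOn (z i) (Ici 0)) (h0 : ∀ t, telegraph ε τ z t =ᵐ[P] 0) (i : D) :
    ∀ᵐ t ∂(volume.restrict (Ici (0 : ℝ))), z i t = 0 := by
  have hτ := hε.switchingTimes
  obtain ⟨n, hn⟩ := hε.exists_measure_state_ne_zero hγ i
  -- The times `τ_n` and `τ_n + v` are random, so the null set must not depend on `t`; continuity of
  -- the paths reduces to a countable dense set of times.
  have hdense : ∀ᵐ ω ∂P, ∀ t : ℝ≥0, telegraph ε τ z t ω = 0 := by
    filter_upwards [ae_all_iff.2 fun k => h0 (TopologicalSpace.denseSeq ℝ≥0 k)] with ω hω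
    have hcont : Continuous fun t : ℝ≥0 => telegraph ε τ z t ω := by
      refine ContinuousOn.comp_continuous (f := fun t : ℝ≥0 => (t : ℝ)) (s := Ici 0)
        (g := fun t : ℝ => ∫ u in (0 : ℝ)..t, dagger ε τ z u ω) (fun x hx => ?_)
        NNReal.continuous_coe fun t => t.coe_nonneg
      have hx0 : (0 : ℝ) ≤ x := hx
      have hx1 : 0 ≤ x + 1 := by positivity
      have hi := hτ.intervalIntegrable_dagger hz' ⟨x + 1, hx1⟩ ω
      have hi' : IntegrableOn (fun u => dagger ε τ z u ω) (uIcc 0 (x + 1)) :=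
        (intervalIntegrable_iff').1 hi
      have hc := intervalIntegral.continuousOn_primitive_interval hi' x
        (by rw [uIcc_of_le hx1]; exact ⟨hx0, (lt_add_one x).le⟩)
      refine hc.mono_of_mem_nhdsWithin ?_
      rw [uIcc_of_le hx1, ← Ici_inter_Iic]
      exact inter_mem_nhdsWithin _ (Iic_mem_nhds (lt_add_one x))
    exact fun t => congrFun (Continuous.ext_on (TopologicalSpace.denseRange_denseSeq ℝ≥0) hcont
      continuous_const (by rintro _ ⟨k, rfl⟩; exact hω k)) t
  refine ae_eq_zero_of_primitive_eq_zero (hz' i) fun v hv => ?_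
  lift v to ℝ≥0 using hv
  have hpos : P ({ω | ε (τ n ω) ω = i} ∩ {ω | (v : ℝ) < holdingTime τ n ω}) ≠ 0 := by
    have h1 := hε.measure_Ioi hγ n i (B := univ) MeasurableSet.univ v.coe_nonneg
    rw [univ_inter] at h1
    rw [h1]
    exact mul_ne_zero hn (by simp [survival_pos])
  obtain ⟨ω, ⟨hω1, hω2⟩, hω3⟩ : ∃ ω ∈ {ω | ε (τ n ω) ω = i} ∩ {ω | (v : ℝ) < holdingTime τ n ω},
      ∀ t : ℝ≥0, telegraph ε τ z t ω = 0 := by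
    by_contra! hcon
    refine hpos (measure_mono_null (fun ω hω => ?_) (ae_iff.1 hdense))
    simpa using hcon ω hω
  have hlt : τ n ω + v < τ (n + 1) ω := by
    rw [← NNReal.coe_lt_coe, NNReal.coe_add]
    have : (v : ℝ) < (τ (n + 1) ω : ℝ) - τ n ω := hω2
    linarith
  have hs : telegraph ε τ z (τ n ω + v) ω - telegraph ε τ z (τ n ω) ω =
      ∫ u in (0 : ℝ)..v, z i u := by
    have hle : (τ n ω : ℝ) ≤ (τ n ω + v : ℝ≥0) := NNReal.coe_le_coe.2 le_self_add
    rw [telegraph, telegraph, intervalIntegral.integral_interval_sub_left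
      (hτ.intervalIntegrable_dagger hz' _ ω) (hτ.intervalIntegrable_dagger hz' _ ω)]
    have hcongr : ∫ u in (τ n ω : ℝ)..(τ n ω + v : ℝ≥0), dagger ε τ z u ω =
        ∫ u in (τ n ω : ℝ)..(τ n ω + v : ℝ≥0), z i (u - τ n ω) := by
      refine intervalIntegral.integral_congr fun u hu => ?_
      rw [uIcc_of_le hle] at hu
      rw [hτ.dagger_eq z hu.1 (hu.2.trans_lt (NNReal.coe_lt_coe.2 hlt)),
        show ε (τ n ω) ω = i from hω1]
    rw [hcongr, intervalIntegral.integral_comp_sub_right (fun u => z i u)]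
    simp
  rw [← hs, hω3, hω3, sub_zero]

end Converse

/-! ### The characterisation of martingales -/

section Characterisation

variable [Fintype D] [DecidableEq D] [Nontrivial D] [MeasurableSpace D]
  [MeasurableSingletonClass D] {mΩ : MeasurableSpace Ω} {P : Measure Ω} [IsProbabilityMeasure P]
  {ℱ : Filtration ℝ≥0 mΩ} {γ : D → D → ℝ → ℝ} {ε : ℝ≥0 → Ω → D} {τ : ℕ → Ω → ℝ≥0}
  {c h : D → ℝ → ℝ}

/-- If `X` is a martingale, then so is the telegraph process driven by `γ h + c`, as the
difference of `X` and its compensated jump part. -/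
theorem IsSemiMarkov.martingale_telegraph (hγ : IsHazardRates γ) (hε : IsSemiMarkov P ℱ γ ε τ)
    (hc' : ∀ i, LocallyIntegrableOn (c i) (Ici 0)) (hh : ∀ i, Measurable (h i))
    (hγh : ∀ i, LocallyIntegrableOn (fun u => totalHazard γ i u * h i u) (Ici 0))
    (hM : Martingale (switchingProcess ε τ c h) ℱ P) :
    Martingale (telegraph ε τ fun i u => totalHazard γ i u * h i u + c i u) ℱ P := by
  -- The drift `-γ_i h_i` satisfies the balance equation identically, and its local integrability
  -- permits the use of sufficiency. In `X - X'` the jump parts cancel.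
  have hX' : Martingale (switchingProcess ε τ (fun i u => -(totalHazard γ i u * h i u)) h) ℱ P :=
    hε.martingale_switchingProcess hγ
      (fun i => ((hγ.measurable_totalHazard i).mul (hh i)).neg) (fun i => (hγh i).neg) hh
      fun i => ae_of_all _ fun t => add_neg_cancel _
  convert hM.sub hX' using 1
  ext t ω
  have h1 := hε.switchingTimes.intervalIntegrable_dagger hc' t ω
  have h2 := hε.switchingTimes.intervalIntegrable_dagger
    (z := fun i u => -(totalHazard γ i u * h i u)) (fun i => (hγh i).neg) t ω
  simp only [Pi.sub_apply, switchingProcess, add_sub_add_right_eq_sub, telegraph]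
  rw [← intervalIntegral.integral_sub h1 h2]
  refine intervalIntegral.integral_congr fun u _ => ?_
  simp only [dagger]
  ring

theorem IsSemiMarkov.ae_eq_zero_of_martingale (hγ : IsHazardRates γ)
    (hε : IsSemiMarkov P ℱ γ ε τ) (hc : ∀ i, Measurable (c i))
    (hc' : ∀ i, LocallyIntegrableOn (c i) (Ici 0)) (hh : ∀ i, Measurable (h i))
    (hM : Martingale (switchingProcess ε τ c h) ℱ P) (i : D) :
    ∀ᵐ t ∂(volume.restrict (Ici (0 : ℝ))), totalHazard γ i t * h i t + c i t = 0 := by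
  have hγh := hε.locallyIntegrableOn_hazard_mul hγ hc' hh hM.integrable
  have hψ' : ∀ i, LocallyIntegrableOn (fun u => totalHazard γ i u * h i u + c i u) (Ici 0) :=
    fun i => (hγh i).add (hc' i)
  exact hε.ae_eq_zero_of_telegraph hγ hψ' (hε.telegraph_ae_eq_zero hγ
    (fun i => ((hγ.measurable_totalHazard i).mul (hh i)).add (hc i)) hψ'
    (hε.martingale_telegraph hγ hc' hh hγh hM)) i

end Characterisation

end RegimeSwitching

end

theorem theorem3p1 {Ω D : Type*} [Fintype D] [DecidableEq D] [Nontrivial D]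
    [MeasurableSpace D] [MeasurableSingletonClass D]
    {mΩ : MeasurableSpace Ω} (P : Measure Ω) [IsProbabilityMeasure P]
    (ℱ : Filtration ℝ≥0 mΩ)
    (γ : D → D → ℝ → ℝ) (hγ : RegimeSwitching.IsHazardRates γ)
    (ε : ℝ≥0 → Ω → D) (τ : ℕ → Ω → ℝ≥0)
    (hε : RegimeSwitching.IsSemiMarkov P ℱ γ ε τ)
    (c h : D → ℝ → ℝ)
    (hc : ∀ i, Measurable (c i)) (hc_int : ∀ i, LocallyIntegrableOn (c i) (Ici 0))
    (hh : ∀ i, Measurable (h i)) :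
    Martingale (RegimeSwitching.switchingProcess ε τ c h) ℱ P ↔
      ∀ i, ∀ᵐ t ∂(volume.restrict (Ici (0 : ℝ))),
        RegimeSwitching.totalHazard γ i t * h i t + c i t = 0 := by
  exact ⟨fun hM i => hε.ae_eq_zero_of_martingale hγ hc hc_int hh hM i,
    hε.martingale_switchingProcess hγ hc hc_int hh⟩
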